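/- Let $n\in\mathbb N$, $\alpha\in(0,2)$, let $A$ be any real $n\times n$ matrix, and let $Z=(Z_t)_{t\ge 0}$ be an $n$-dimensional symmetric non-degenerate $\alpha$-stable process on a probability space. That is, $Z$ is a Lévy process (with càdlàg paths, $Z_0=0$) such that $$\mathbb E\,e^{i\langle Z_t,u\rangle}=e^{-t\psi(u)},\qquad \psi(u)=-\int_{\mathbb R^n}\big(e^{i\langle u,y\rangle}-1-i\langle u,y\rangle 1_{\{|y|\le 1\}}\big)\,\nu(dy),\qquad u\in\mathbb R^n,\ t\ge 0,$$ where $$\nu(D)=\int_{S}\mu(d\xi)\int_0^\infty 1_D(r\xi)\,\frac{dr}{r^{1+\alpha}}$$ for Borel sets $D\subset\mathbb R^n$ and some symmetric, non-zero, finite measure $\mu$ concentrated on the unit sphere $S$ of $\mathbb R^n$, and such that there is a constant $C>0$ with $\psi(u)\ge C|u|^\alpha$ for all $u\in\mathbb R^n$. For $x\in\mathbb R^n$ let $X^x$ be the solution, a process with càdlàg paths, of $dX_t=AX_t\,dt+dZ_t$, $X_0=x$, i.e. almost surely $X_t=x+\int_0^tAX_s\,ds+Z_t$ for all $t\ge0$;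 and let $R_tf(x)=\mathbb E[f(X^x_t)]$ be the associated Ornstein–Uhlenbeck semigroup, acting on bounded Borel functions $f:\mathbb R^n\to\mathbb R$. Write $\|f\|_0=\sup_x|f(x)|$. Then there is a constant $c>0$, independent of $t$ and $f$, such that for every $t\in(0,1]$ and every bounded Borel function $f:\mathbb R^n\to\mathbb R$ the function $R_tf$ is differentiable on $\mathbb R^n$ and $$\|DR_tf\|_0=\sup_{x\in\mathbb R^n}|DR_tf(x)|\le\frac{c}{t^{1/\alpha}}\,\|f\|_0 .$$ -/

import Mathlib

open MeasureTheory ProbabilityTheory Filter Topology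
open scoped NNReal ENNReal

noncomputable section

namespace OUGradient

/-- A function of time `t ≥ 0` is càdlàg: right-continuous with left limits. -/
def IsCadlag {E : Type*} [TopologicalSpace E] (z : ℝ≥0 → E) : Prop :=
  ∀ t : ℝ≥0, ContinuousWithinAt z (Set.Ici t) t ∧ ∃ l : E, Tendsto z (𝓝[<] t) (𝓝 l)

/-- `Z` is a Lévy process: it starts at `0`, has independent and stationary increments and
càdlàg paths (almost surely). -/
structure IsLevyProcess {Ω : Type*} [MeasurableSpace Ω] {n : ℕ}
    (Z : ℝ≥0 → Ω → EuclideanSpace ℝ (Fin n)) (P : Measure Ω) : Prop where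
  measurable : ∀ t, Measurable (Z t)
  zero : ∀ᵐ ω ∂P, Z 0 ω = 0
  indep : HasIndepIncrements Z P
  stationary : ∀ s t : ℝ≥0, IdentDistrib (fun ω => Z (s + t) ω - Z s ω) (Z t) P P
  cadlag : ∀ᵐ ω ∂P, IsCadlag (fun t => Z t ω)

/-- The measure `D ↦ ∫ μ(dξ) ∫_0^∞ 1_D(r ξ) dr / r^(1+α)`. -/
def stableLevyMeasure {n : ℕ} (α : ℝ) (μ : Measure (EuclideanSpace ℝ (Fin n))) :
    Measure (EuclideanSpace ℝ (Fin n)) :=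
  (μ.prod ((volume.restrict (Set.Ioi (0 : ℝ))).withDensity
    (fun r : ℝ => ENNReal.ofReal (1 / r ^ (1 + α))))).map
      (fun p : EuclideanSpace ℝ (Fin n) × ℝ => p.2 • p.1)

/-- The polar-coordinates formula that characterizes `stableLevyMeasure`. -/
theorem stableLevyMeasure_apply {n : ℕ} (α : ℝ) (μ : Measure (EuclideanSpace ℝ (Fin n)))
    {D : Set (EuclideanSpace ℝ (Fin n))} (hD : MeasurableSet D) :
    stableLevyMeasure α μ D =
      ∫⁻ ξ, (∫⁻ r in Set.Ioi (0 : ℝ),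
        ENNReal.ofReal (1 / r ^ (1 + α)) * D.indicator 1 (r • ξ)) ∂μ := by
  have hm : Measurable (fun p : EuclideanSpace ℝ (Fin n) × ℝ => p.2 • p.1) := by fun_prop
  have hg : Measurable (fun r : ℝ => ENNReal.ofReal (1 / r ^ (1 + α))) := by fun_prop
  rw [stableLevyMeasure, Measure.map_apply hm hD, Measure.prod_apply (hm hD)]
  refine lintegral_congr fun ξ => ?_
  have hs : Measurable (fun r : ℝ => r • ξ) := by fun_prop
  rw [← lintegral_indicator_one (measurable_prodMk_left (hm hD)),
    lintegral_withDensity_eq_lintegral_mul _ hg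
      (measurable_one.indicator (measurable_prodMk_left (hm hD)))]
  rfl

/-- The exponent `ψ(u) = -∫ (e^{i⟨u,y⟩} - 1 - i⟨u,y⟩ 1_{|y| ≤ 1}) ν(dy)` of a Lévy measure `ν`. -/
def levyExponent {n : ℕ} (ν : Measure (EuclideanSpace ℝ (Fin n)))
    (u : EuclideanSpace ℝ (Fin n)) : ℂ :=
  -∫ y, (Complex.exp (Complex.I * (inner ℝ u y : ℝ)) - 1
    - (Metric.closedBall (0 : EuclideanSpace ℝ (Fin n)) 1).indicator
        (fun y => Complex.I * (inner ℝ u y : ℝ)) y) ∂ν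

/-- `Z` is a symmetric non-degenerate `α`-stable process: a Lévy process with
`E e^{i⟨Z_t,u⟩} = e^{-tψ(u)}`, where `ψ` is the exponent of the Lévy measure built from a symmetric,
non-zero finite measure `μ` concentrated on the unit sphere, and `ψ(u) ≥ C |u|^α` for some `C > 0`
(`ψ` is real because `μ` is symmetric). -/
def IsSymmNondegStable {Ω : Type*} [MeasurableSpace Ω] {n : ℕ} (α : ℝ)
    (Z : ℝ≥0 → Ω → EuclideanSpace ℝ (Fin n)) (P : Measure Ω) : Prop :=
  IsLevyProcess Z P ∧
  ∃ μ : Measure (EuclideanSpace ℝ (Fin n)),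
    IsFiniteMeasure μ ∧ μ ≠ 0 ∧ μ (Metric.sphere 0 1)ᶜ = 0 ∧ μ.map (fun ξ => -ξ) = μ ∧
    (∀ (t : ℝ≥0) (u : EuclideanSpace ℝ (Fin n)),
      ∫ ω, Complex.exp (Complex.I * (inner ℝ (Z t ω) u : ℝ)) ∂P =
        Complex.exp (-(t : ℝ) * levyExponent (stableLevyMeasure α μ) u)) ∧
    ∃ C : ℝ, 0 < C ∧ ∀ u : EuclideanSpace ℝ (Fin n),
      C * ‖u‖ ^ α ≤ (levyExponent (stableLevyMeasure α μ) u).re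

/-- `X` is a solution of `dX_t = A X_t dt + dZ_t`, `X_0 = x`: a process with càdlàg paths such that,
almost surely, `X_t = x + ∫_0^t A X_s ds + Z_t` for all `t ≥ 0`. -/
structure IsOUSolution {Ω : Type*} [MeasurableSpace Ω] {n : ℕ}
    (A : Matrix (Fin n) (Fin n) ℝ) (Z : ℝ≥0 → Ω → EuclideanSpace ℝ (Fin n)) (P : Measure Ω)
    (x : EuclideanSpace ℝ (Fin n)) (X : ℝ≥0 → Ω → EuclideanSpace ℝ (Fin n)) : Prop where
  measurable : ∀ t, Measurable (X t)
  cadlag : ∀ᵐ ω ∂P, IsCadlag (fun t => X t ω)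
  equation : ∀ᵐ ω ∂P, ∀ t : ℝ≥0,
    X t ω = x + (∫ s in (0 : ℝ)..t, Matrix.toEuclideanLin A (X s.toNNReal ω)) + Z t ω

/-- `R_t f(x) = E f(X_t^x)`, for a family `X` of processes indexed by the starting point `x`. -/
def semigroup {Ω : Type*} [MeasurableSpace Ω] {n : ℕ} (P : Measure Ω)
    (X : EuclideanSpace ℝ (Fin n) → ℝ≥0 → Ω → EuclideanSpace ℝ (Fin n)) (t : ℝ≥0)
    (f : EuclideanSpace ℝ (Fin n) → ℝ) (x : EuclideanSpace ℝ (Fin n)) : ℝ :=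
  ∫ ω, f (X x t ω) ∂P

/-- The supremum norm `‖f‖₀ = sup_x |f x|` (used for bounded `f` only). -/
def supNorm {n : ℕ} (f : EuclideanSpace ℝ (Fin n) → ℝ) : ℝ :=
  ⨆ x, |f x|

end OUGradient

end

/-! Variation of constants gives `X_t = e^{tA} x + Y_t`, where `Y_t` is the stochastic convolution
of `Z` with the flow. Its characteristic function is `exp (-∫_0^t ψ(e^{sA*} u) ds)`. Since `ψ` is
homogeneous of degree `α`, the rescaled variable `t^{-1/α} Y_t` has exponent `∫_0^1 ψ(e^{θtA*} u)
dθ`. For `t ≤ 1` this is a unit-time problem whose flow is bounded, with bounded inverse, uniformly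
in `t`. If the law `L` of the rescaled variable satisfies `|D ∫ f(z + y) L(dy)| ≤ K ‖f‖₀` uniformly
in `t`, composing with `T = t^{-1/α} e^{tA}` gives the theorem, and the singular factor is the norm
of `T`.

For the uniform estimate (`gradient_estimate_of_flow`), split the Lévy measure at `|y| = 1`. The
large jumps have finite mass, so they contribute a compound Poisson factor `m` and reduce the lower
bound `C|u|^α` by only a constant. The small jumps, carried along by the flow, form a measure of
bounded support and finite second moment. Hence their exponent is smooth with polynomially bounded
derivatives, and its exponential decays like `exp (-c|u|^α)`. It is therefore a Schwartz function
whose seminorms are bounded independently of the flow, and Fourier inversion gives a Schwartz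
density `q` with `∫ |Dq| ≤ K` (`exists_schwartz_density`). Thus `L = q * m`, and in `D ∫ f(z + y)
L(dy)` the derivative can be put on `q` (`gradient_estimate_of_charFun`).

No stochastic integral is needed: integration by parts writes `Y_t` pathwise through an ordinary
integral of `Z` (`eq_flow_add_stochConv`), and its law is found as a limit of sums of independent
increments (`charFun_stochConv`). -/

set_option linter.unusedSectionVars false

noncomputable section

namespace OUGradient

/-! ### Compound Poisson laws and their characteristic functions -/

section CompoundPoisson

variable {E : Type*} [NormedAddCommGroup E] [InnerProductSpace ℝ E] [MeasurableSpace E]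
  [BorelSpace E] [SecondCountableTopology E]

/-- The `k`-fold convolution power of a measure. -/
def convPow (ρ : Measure E) : ℕ → Measure E
  | 0 => Measure.dirac 0
  | k + 1 => (convPow ρ k).conv ρ

instance isFiniteMeasure_convPow (ρ : Measure E) [IsFiniteMeasure ρ] (k : ℕ) :
    IsFiniteMeasure (convPow ρ k) := by
  induction k with
  | zero => simp only [convPow]; infer_instance
  | succ k ih => simp only [convPow]; infer_instance

theorem charFun_convPow (ρ : Measure E) [IsFiniteMeasure ρ] (k : ℕ) (u : E) :
    charFun (convPow ρ k) u = charFun ρ u ^ k := by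
  induction k with
  | zero => simp [convPow]
  | succ k ih => rw [convPow, charFun_conv, ih, pow_succ]

theorem convPow_univ (ρ : Measure E) [IsFiniteMeasure ρ] (k : ℕ) :
    convPow ρ k Set.univ = ENNReal.ofReal (ρ.real Set.univ ^ k) := by
  have h := charFun_convPow ρ k 0
  rw [charFun_zero, charFun_zero] at h
  have h' : (convPow ρ k).real Set.univ = ρ.real Set.univ ^ k := by exact_mod_cast h
  rw [← h', ofReal_measureReal]

/-- The compound Poisson distribution with jump measure `ρ`. -/
def compoundPoisson (ρ : Measure E) : Measure E :=
  Measure.sum fun k : ℕ =>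
    ENNReal.ofReal (Real.exp (-ρ.real Set.univ) / k.factorial) • convPow ρ k

instance isProbabilityMeasure_compoundPoisson (ρ : Measure E) [IsFiniteMeasure ρ] :
    IsProbabilityMeasure (compoundPoisson ρ) := by
  refine ⟨?_⟩
  set l := ρ.real Set.univ with hl
  have hl0 : 0 ≤ l := measureReal_nonneg
  have hs : HasSum (fun k : ℕ => Real.exp (-l) * (l ^ k / k.factorial)) 1 := by
    have := (NormedSpace.expSeries_div_hasSum_exp (𝔸 := ℝ) l).mul_left (Real.exp (-l))
    rwa [← Real.exp_eq_exp_ℝ, ← Real.exp_add, neg_add_cancel, Real.exp_zero] at this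
  rw [compoundPoisson, Measure.sum_apply _ MeasurableSet.univ]
  calc ∑' k : ℕ, (ENNReal.ofReal (Real.exp (-l) / k.factorial) • convPow ρ k) Set.univ
      = ∑' k : ℕ, ENNReal.ofReal (Real.exp (-l) * (l ^ k / k.factorial)) := by
        refine tsum_congr fun k => ?_
        rw [Measure.smul_apply, convPow_univ, smul_eq_mul, ← ENNReal.ofReal_mul (by positivity)]
        congr 1; ring
    _ = 1 := by
        rw [← ENNReal.ofReal_tsum_of_nonneg (fun k => by positivity) hs.summable, hs.tsum_eq,
          ENNReal.ofReal_one]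

/-- Convolution powers become powers of `charFun ρ u`, and the Poisson weights sum them to an
exponential series. This realizes the finite large-jump part of the exponent by a genuine
probability measure. -/
theorem charFun_compoundPoisson (ρ : Measure E) [IsFiniteMeasure ρ] (u : E) :
    charFun (compoundPoisson ρ) u = Complex.exp (charFun ρ u - ρ.real Set.univ) := by
  have hi : Integrable (fun x => Complex.exp (inner ℝ x u * Complex.I)) (compoundPoisson ρ) := by
    refine (integrable_const (1 : ℝ)).mono' (by fun_prop) (ae_of_all _ fun x => ?_)
    rw [Complex.norm_exp_ofReal_mul_I]
  have hs := (NormedSpace.expSeries_div_hasSum_exp (𝔸 := ℂ) (charFun ρ u)).mul_left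
    (Complex.exp (-(ρ.real Set.univ : ℂ)))
  rw [← Complex.exp_eq_exp_ℂ] at hs
  rw [charFun_apply, compoundPoisson, integral_sum_measure hi, sub_eq_neg_add, Complex.exp_add,
    ← hs.tsum_eq]
  refine tsum_congr fun k => ?_
  rw [integral_smul_measure, ← charFun_apply, charFun_convPow,
    ENNReal.toReal_ofReal (by positivity), Complex.real_smul]
  push_cast
  ring

end CompoundPoisson

/-! ### The compensated Lévy exponent and its first two derivatives -/

section CompensatedExponent

variable {E : Type*} [NormedAddCommGroup E] [InnerProductSpace ℝ E]

/-- The functional `u ↦ i⟨y, u⟩`. -/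
def imInner (y : E) : E →L[ℝ] ℂ :=
  (ContinuousLinearMap.smulRight (innerSL ℝ y) Complex.I)

@[simp] theorem imInner_apply (y u : E) : imInner y u = (inner ℝ y u : ℝ) * Complex.I := by
  simp [imInner]

theorem norm_imInner (y : E) : ‖imInner y‖ = ‖y‖ := by
  simp [imInner, ContinuousLinearMap.norm_smulRight_apply]

theorem continuous_imInner : Continuous (imInner : E → E →L[ℝ] ℂ) := by
  unfold imInner; fun_prop

theorem norm_exp_imInner (y u : E) : ‖Complex.exp (imInner y u)‖ = 1 := by
  rw [imInner_apply, Complex.norm_exp_ofReal_mul_I]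

theorem norm_one_sub_exp_imInner_le (y u : E) :
    ‖1 - Complex.exp (imInner y u)‖ ≤ ‖y‖ * ‖u‖ := by
  rw [norm_sub_rev, imInner_apply, mul_comm]
  exact (Real.norm_exp_I_mul_ofReal_sub_one_le).trans (norm_inner_le_norm y u)

theorem hasFDerivAt_exp_imInner (y u : E) :
    HasFDerivAt (fun u => Complex.exp (imInner y u)) (Complex.exp (imInner y u) • imInner y) u :=
  (imInner y).hasFDerivAt.cexp

theorem hasFDerivAt_one_add_sub_exp (y v : E) :
    HasFDerivAt (fun u => 1 + imInner y u - Complex.exp (imInner y u))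
      ((1 - Complex.exp (imInner y v)) • imInner y) v := by
  refine ((((imInner y).hasFDerivAt (x := v)).const_add (1 : ℂ)).sub
    (hasFDerivAt_exp_imInner y v)).congr_fderiv ?_
  ext a
  simp [sub_mul]

/-- Mean value inequality on the ball of radius `‖u‖`, where the derivative in `u` is at most `‖y‖ ^
2 * ‖u‖`. The compensator makes a finite second moment suffice, so `ρ` may have infinite mass. -/
theorem norm_one_add_sub_exp_le (y u : E) :
    ‖1 + imInner y u - Complex.exp (imInner y u)‖ ≤ ‖y‖ ^ 2 * ‖u‖ ^ 2 := by
  have hd : ∀ v ∈ Metric.closedBall (0 : E) ‖u‖,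
      HasFDerivWithinAt (fun u => 1 + imInner y u - Complex.exp (imInner y u))
        ((1 - Complex.exp (imInner y v)) • imInner y) (Metric.closedBall (0 : E) ‖u‖) v :=
    fun v _ => (hasFDerivAt_one_add_sub_exp y v).hasFDerivWithinAt
  have hb : ∀ v ∈ Metric.closedBall (0 : E) ‖u‖,
      ‖(1 - Complex.exp (imInner y v)) • imInner y‖ ≤ ‖y‖ ^ 2 * ‖u‖ := by
    intro v hv
    rw [norm_smul, norm_imInner]
    have h1 := norm_one_sub_exp_imInner_le y v
    have h2 : ‖v‖ ≤ ‖u‖ := by simpa using hv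
    calc _ ≤ (‖y‖ * ‖u‖) * ‖y‖ := by gcongr; exact h1.trans (by gcongr)
      _ = _ := by ring
  have := (convex_closedBall (0 : E) ‖u‖).norm_image_sub_le_of_norm_hasFDerivWithin_le hd hb
    (x := 0) (y := u) (by simp) (by simp)
  simp only [map_zero, Complex.exp_zero, sub_zero, add_zero, sub_self] at this
  calc _ ≤ _ := this
    _ = _ := by ring

variable [MeasurableSpace E]

/-- The compensated exponent `∫ (1 + i⟨y, u⟩ - e^{i⟨y, u⟩}) ρ(dy)`. -/
def compExponent (ρ : Measure E) (u : E) : ℂ :=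
  ∫ y, (1 + imInner y u - Complex.exp (imInner y u)) ∂ρ

variable [FiniteDimensional ℝ E] [BorelSpace E] {ρ : Measure E}

theorem integrable_one_add_sub_exp (hρ : Integrable (fun y => ‖y‖ ^ 2) ρ) (u : E) :
    Integrable (fun y => 1 + imInner y u - Complex.exp (imInner y u)) ρ := by
  refine (hρ.mul_const (‖u‖ ^ 2)).mono' ?_ (ae_of_all _ fun y => norm_one_add_sub_exp_le y u)
  have := (continuous_imInner (E := E)).clm_apply (continuous_const (y := u))
  exact (by fun_prop : Continuous _).aestronglyMeasurable

/-- The derivative of `compExponent ρ`. -/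
def compExponentDeriv (ρ : Measure E) (u : E) : E →L[ℝ] ℂ :=
  ∫ y, (1 - Complex.exp (imInner y u)) • imInner y ∂ρ

theorem norm_compExponentDeriv_integrand_le (y u : E) :
    ‖(1 - Complex.exp (imInner y u)) • imInner y‖ ≤ ‖y‖ ^ 2 * ‖u‖ := by
  rw [norm_smul, norm_imInner]
  nlinarith [norm_one_sub_exp_imInner_le y u, norm_nonneg y]

theorem aestronglyMeasurable_compExponentDeriv_integrand (u : E) :
    AEStronglyMeasurable (fun y => (1 - Complex.exp (imInner y u)) • imInner y) ρ := by
  have := (continuous_imInner (E := E)).clm_apply (continuous_const (y := u))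
  have h2 := continuous_imInner (E := E)
  exact (by fun_prop : Continuous _).aestronglyMeasurable

theorem integrable_compExponentDeriv_integrand (hρ : Integrable (fun y => ‖y‖ ^ 2) ρ) (u : E) :
    Integrable (fun y => (1 - Complex.exp (imInner y u)) • imInner y) ρ :=
  (hρ.mul_const ‖u‖).mono' (aestronglyMeasurable_compExponentDeriv_integrand u)
    (ae_of_all _ fun y => norm_compExponentDeriv_integrand_le y u)

theorem hasFDerivAt_compExponent (hρ : Integrable (fun y => ‖y‖ ^ 2) ρ) (u : E) :
    HasFDerivAt (compExponent ρ) (compExponentDeriv ρ u) u := by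
  refine hasFDerivAt_integral_of_dominated_of_fderiv_le (μ := ρ)
    (F := fun u y => 1 + imInner y u - Complex.exp (imInner y u))
    (F' := fun u y => (1 - Complex.exp (imInner y u)) • imInner y)
    (Metric.ball_mem_nhds u one_pos)
    (Eventually.of_forall fun v => (integrable_one_add_sub_exp hρ v).aestronglyMeasurable)
    (integrable_one_add_sub_exp hρ u) (aestronglyMeasurable_compExponentDeriv_integrand u)
    (bound := fun y => ‖y‖ ^ 2 * (‖u‖ + 1)) (ae_of_all _ fun y v hv => ?_) (hρ.mul_const _)
    (ae_of_all _ fun y v _ => ?_)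
  · refine (norm_compExponentDeriv_integrand_le y v).trans ?_
    gcongr
    have : ‖v - u‖ < 1 := by simpa [dist_eq_norm] using hv
    linarith [norm_le_norm_add_norm_sub' v u]
  · exact hasFDerivAt_one_add_sub_exp y v

theorem norm_compExponentDeriv_le (hρ : Integrable (fun y => ‖y‖ ^ 2) ρ) (u : E) :
    ‖compExponentDeriv ρ u‖ ≤ (∫ y, ‖y‖ ^ 2 ∂ρ) * ‖u‖ := by
  rw [← integral_mul_const]
  exact norm_integral_le_of_norm_le (hρ.mul_const _)
    (ae_of_all _ fun y => norm_compExponentDeriv_integrand_le y u)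

/-- The bilinear form `(a, b) ↦ ⟨y, a⟩⟨y, b⟩`. -/
def innerSqForm (y : E) : E →L[ℝ] E →L[ℝ] ℂ :=
  (innerSL ℝ y).smulRight (-Complex.I • imInner y)

theorem norm_innerSqForm (y : E) : ‖innerSqForm y‖ = ‖y‖ ^ 2 := by
  rw [innerSqForm, ContinuousLinearMap.norm_smulRight_apply, norm_smul, norm_imInner]
  simp [sq]

theorem continuous_innerSqForm : Continuous (innerSqForm : E → E →L[ℝ] E →L[ℝ] ℂ) := by
  exact (ContinuousLinearMap.smulRightL ℝ E (E →L[ℝ] ℂ)).continuous₂.comp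
    ((innerSL ℝ).continuous.prodMk ((continuous_imInner (E := E)).const_smul (-Complex.I)))

/-- The second derivative of `compExponent ρ`. -/
def compExponentHess (ρ : Measure E) (u : E) : E →L[ℝ] E →L[ℝ] ℂ :=
  ∫ y, Complex.exp (imInner y u) • innerSqForm y ∂ρ

theorem hasFDerivAt_compExponentDeriv (hρ : Integrable (fun y => ‖y‖ ^ 2) ρ) (u : E) :
    HasFDerivAt (compExponentDeriv ρ) (compExponentHess ρ u) u := by
  refine hasFDerivAt_integral_of_dominated_of_fderiv_le (μ := ρ)
    (F := fun u y => (1 - Complex.exp (imInner y u)) • imInner y)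
    (F' := fun u y => Complex.exp (imInner y u) • innerSqForm y) (s := Set.univ) Filter.univ_mem
    (Eventually.of_forall fun v => aestronglyMeasurable_compExponentDeriv_integrand v)
    (integrable_compExponentDeriv_integrand hρ u) ?_
    (bound := fun y => ‖y‖ ^ 2) (ae_of_all _ fun y v _ => ?_) hρ
    (ae_of_all _ fun y v _ => ?_)
  · have := (continuous_imInner (E := E)).clm_apply (continuous_const (y := u))
    have h2 := continuous_innerSqForm (E := E)
    exact (by fun_prop : Continuous _).aestronglyMeasurable
  · rw [norm_smul, norm_exp_imInner, norm_innerSqForm, one_mul]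
  · refine (((hasFDerivAt_exp_imInner y v).const_sub (1 : ℂ)).smul_const
      (imInner y)).congr_fderiv ?_
    ext a b
    simp [innerSqForm]
    ring

/-- After two derivatives the integrand is a character times a form of norm `‖y‖ ^ 2`, which is
integrable, so the general theory of Fourier integrals yields all further derivatives. The factor
`-(2π)⁻¹` undoes the normalization `e^{-2πi·}`. -/
theorem compExponentHess_eq_fourierIntegral (ρ : Measure E) :
    compExponentHess ρ = VectorFourier.fourierIntegral Real.fourierChar ρ
      (ContinuousLinearMap.toLinearMap₁₂ (-(2 * Real.pi)⁻¹ • innerSL ℝ : E →L[ℝ] E →L[ℝ] ℝ))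
      innerSqForm := by
  ext1 u
  refine integral_congr_ae (ae_of_all _ fun y => ?_)
  simp only [Circle.smul_def, Real.fourierChar_apply]
  congr 2
  simp
  field_simp
  rfl

end CompensatedExponent

/-! ### Smoothness of the exponent and Schwartz decay of its exponential -/

section CompensatedExponentBounds

open scoped ContDiff

variable {E : Type*} [NormedAddCommGroup E] [InnerProductSpace ℝ E] [FiniteDimensional ℝ E]
  [MeasurableSpace E] [BorelSpace E] {ρ : Measure E} {R M₂ : ℝ}

theorem integrable_pow_mul_norm_innerSqForm (hR : ∀ᵐ y ∂ρ, ‖y‖ ≤ R)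
    (hρ : Integrable (fun y => ‖y‖ ^ 2) ρ) (k : ℕ) :
    Integrable (fun y => ‖y‖ ^ k * ‖innerSqForm y‖) ρ := by
  refine (hρ.const_mul (R ^ k)).mono' (by simp only [norm_innerSqForm]; fun_prop) ?_
  filter_upwards [hR] with y hy
  rw [norm_innerSqForm, Real.norm_of_nonneg (by positivity)]
  gcongr

theorem contDiff_compExponentHess (hR : ∀ᵐ y ∂ρ, ‖y‖ ≤ R)
    (hρ : Integrable (fun y => ‖y‖ ^ 2) ρ) : ContDiff ℝ ∞ (compExponentHess ρ) := by
  rw [compExponentHess_eq_fourierIntegral]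
  exact VectorFourier.contDiff_fourierIntegral _
    fun k _ => integrable_pow_mul_norm_innerSqForm hR hρ k

/-- Each derivative brings down one factor `y`, of norm at most `R` on the support, and leaves the
second moment untouched. -/
theorem norm_iteratedFDeriv_compExponentHess_le (hR : ∀ᵐ y ∂ρ, ‖y‖ ≤ R)
    (hρ : Integrable (fun y => ‖y‖ ^ 2) ρ) (k : ℕ) (u : E) :
    ‖iteratedFDeriv ℝ k (compExponentHess ρ) u‖ ≤ R ^ k * ∫ y, ‖y‖ ^ 2 ∂ρ := by
  have hm : AEStronglyMeasurable (innerSqForm : E → E →L[ℝ] E →L[ℝ] ℂ) ρ :=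
    continuous_innerSqForm.aestronglyMeasurable
  rw [compExponentHess_eq_fourierIntegral, VectorFourier.iteratedFDeriv_fourierIntegral (N := ⊤) _
    (fun k _ => integrable_pow_mul_norm_innerSqForm hR hρ k) hm (mod_cast le_top)]
  refine (VectorFourier.norm_fourierIntegral_le_integral_norm _ _ _ _ _).trans ?_
  rw [← integral_const_mul]
  refine integral_mono_of_nonneg (ae_of_all _ fun y => norm_nonneg _) (hρ.const_mul _) ?_
  filter_upwards [hR] with y hy
  refine (VectorFourier.norm_fourierPowSMulRight_le _ _ _ _).trans ?_
  have hL : 2 * Real.pi * ‖(-(2 * Real.pi)⁻¹ • innerSL ℝ : E →L[ℝ] E →L[ℝ] ℝ)‖ ≤ 1 := by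
    have := ContinuousLinearMap.opNorm_le_bound₂
      (-(2 * Real.pi)⁻¹ • innerSL ℝ : E →L[ℝ] E →L[ℝ] ℝ) (C := (2 * Real.pi)⁻¹) (by positivity)
      fun a b => by
        change ‖-(2 * Real.pi)⁻¹ * inner ℝ a b‖ ≤ _
        rw [norm_mul, norm_neg, Real.norm_of_nonneg (by positivity), mul_assoc]
        gcongr
        exact norm_inner_le_norm a b
    calc _ ≤ 2 * Real.pi * (2 * Real.pi)⁻¹ := by gcongr
      _ = 1 := mul_inv_cancel₀ (by positivity)
  rw [norm_innerSqForm]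
  calc _ ≤ 1 ^ k * R ^ k * ‖y‖ ^ 2 := by gcongr
    _ = _ := by ring

theorem fderiv_compExponent (hρ : Integrable (fun y => ‖y‖ ^ 2) ρ) :
    fderiv ℝ (compExponent ρ) = compExponentDeriv ρ :=
  funext fun u => (hasFDerivAt_compExponent hρ u).fderiv

theorem fderiv_compExponentDeriv (hρ : Integrable (fun y => ‖y‖ ^ 2) ρ) :
    fderiv ℝ (compExponentDeriv ρ) = compExponentHess ρ :=
  funext fun u => (hasFDerivAt_compExponentDeriv hρ u).fderiv

theorem contDiff_compExponent (hR : ∀ᵐ y ∂ρ, ‖y‖ ≤ R)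
    (hρ : Integrable (fun y => ‖y‖ ^ 2) ρ) : ContDiff ℝ ∞ (compExponent ρ) := by
  rw [contDiff_infty_iff_fderiv, fderiv_compExponent hρ, contDiff_infty_iff_fderiv,
    fderiv_compExponentDeriv hρ]
  exact ⟨fun u => (hasFDerivAt_compExponent hρ u).differentiableAt,
    fun u => (hasFDerivAt_compExponentDeriv hρ u).differentiableAt,
    contDiff_compExponentHess hR hρ⟩

/-- The bound is deliberately a `k`-th power of one quantity: the Faà di Bruno estimate
`norm_iteratedFDeriv_comp_le` takes inner derivatives in that form. Only the first derivative
actually grows with `u`. -/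
theorem norm_iteratedFDeriv_compExponent_le (hR0 : 0 ≤ R) (hR : ∀ᵐ y ∂ρ, ‖y‖ ≤ R)
    (hρ : Integrable (fun y => ‖y‖ ^ 2) ρ) (hM : ∫ y, ‖y‖ ^ 2 ∂ρ ≤ M₂) {k : ℕ} (hk : 1 ≤ k)
    (u : E) :
    ‖iteratedFDeriv ℝ k (compExponent ρ) u‖ ≤ ((1 + R) * (1 + M₂) * (1 + ‖u‖)) ^ k := by
  have hM0 : 0 ≤ M₂ := (integral_nonneg fun y => by positivity).trans hM
  have hu := norm_nonneg u
  obtain _ | _ | k := k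
  · omega
  · rw [zero_add, ← norm_iteratedFDeriv_fderiv, norm_iteratedFDeriv_zero, fderiv_compExponent hρ,
      pow_one]
    refine (norm_compExponentDeriv_le hρ u).trans ?_
    calc _ ≤ M₂ * ‖u‖ := by gcongr
      _ = 1 * M₂ * ‖u‖ := by ring
      _ ≤ _ := by gcongr <;> linarith
  · rw [← norm_iteratedFDeriv_fderiv, ← norm_iteratedFDeriv_fderiv, fderiv_compExponent hρ,
      fderiv_compExponentDeriv hρ]
    refine (norm_iteratedFDeriv_compExponentHess_le hR hρ k u).trans ?_
    rw [mul_pow, mul_pow]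
    have h1 : R ^ k ≤ (1 + R) ^ (k + 1 + 1) :=
      (pow_le_pow_left₀ hR0 (by linarith) k).trans (pow_le_pow_right₀ (by linarith) (by omega))
    have h2 : M₂ ≤ (1 + M₂) ^ (k + 1 + 1) :=
      (by linarith : M₂ ≤ 1 + M₂).trans (le_self_pow₀ (by linarith) (by omega))
    have h3 : 1 ≤ (1 + ‖u‖) ^ (k + 1 + 1) := one_le_pow₀ (by linarith)
    calc _ ≤ (1 + R) ^ (k + 1 + 1) * (1 + M₂) ^ (k + 1 + 1) * 1 := by
          rw [mul_one]
          exact mul_le_mul h1 (hM.trans h2) (integral_nonneg fun y => by positivity) (by positivity)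
      _ ≤ _ := by gcongr

theorem re_compExponent (hρ : Integrable (fun y => ‖y‖ ^ 2) ρ) (u : E) :
    (compExponent ρ u).re = ∫ y, (1 - Real.cos (inner ℝ u y)) ∂ρ := by
  rw [compExponent, ← RCLike.re_eq_complex_re, ← integral_re (integrable_one_add_sub_exp hρ u)]
  refine integral_congr_ae (ae_of_all _ fun y => ?_)
  simp [Complex.exp_ofReal_mul_I_re, real_inner_comm]

theorem one_add_pow_mul_exp_neg_le {c α : ℝ} (hc : 0 < c) (hα : 0 < α) (N : ℕ) :
    ∃ C : ℝ, 0 ≤ C ∧ ∀ r : ℝ, 0 ≤ r → (1 + r) ^ N * Real.exp (-(c * r ^ α)) ≤ C := by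
  -- With `N ≤ α j`, `r ^ N ≤ (r ^ α) ^ j` for `r ≥ 1`, and the `j`-th term of the exponential
  -- series absorbs it.
  obtain ⟨j, hj⟩ := exists_nat_ge (N / α)
  have hj' : (N : ℝ) ≤ α * j := by rwa [div_le_iff₀' hα] at hj
  refine ⟨2 ^ N * (1 + j.factorial / c ^ j), by positivity, fun r hr => ?_⟩
  have hexp : Real.exp (-(c * r ^ α)) ≤ 1 := Real.exp_le_one_iff.2 (by
    have := Real.rpow_nonneg hr α
    nlinarith)
  rcases le_total r 1 with h1 | h1
  · calc (1 + r) ^ N * Real.exp (-(c * r ^ α)) ≤ 2 ^ N * 1 := by gcongr; linarith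
      _ ≤ _ := by gcongr; linarith [show 0 ≤ j.factorial / c ^ j by positivity]
  · have h2 : r ^ N ≤ (r ^ α) ^ j := by
      rw [← Real.rpow_natCast, ← Real.rpow_natCast, ← Real.rpow_mul hr]
      exact Real.rpow_le_rpow_of_exponent_le h1 hj'
    have h3 := Real.pow_div_factorial_le_exp (c * r ^ α) (by positivity) j
    rw [mul_pow, div_le_iff₀ (by positivity)] at h3
    have h4 : (r ^ α) ^ j ≤ j.factorial / c ^ j * Real.exp (c * r ^ α) := by
      rw [div_mul_eq_mul_div, le_div_iff₀ (by positivity)]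
      linarith
    calc (1 + r) ^ N * Real.exp (-(c * r ^ α))
        ≤ (2 * r) ^ N * Real.exp (-(c * r ^ α)) := by gcongr; linarith
      _ ≤ 2 ^ N * (j.factorial / c ^ j * Real.exp (c * r ^ α)) * Real.exp (-(c * r ^ α)) := by
          rw [mul_pow]
          gcongr
          exact h2.trans h4
      _ = 2 ^ N * (j.factorial / c ^ j) := by
          rw [mul_assoc, mul_assoc, ← Real.exp_add, add_neg_cancel, Real.exp_zero, mul_one]
      _ ≤ _ := by gcongr; linarith

/-- The function `exp (-Re (compExponent ρ))`. -/
def expNegExponent (ρ : Measure E) (u : E) : ℝ :=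
  Real.exp (-(compExponent ρ u).re)

theorem contDiff_expNegExponent (hR : ∀ᵐ y ∂ρ, ‖y‖ ≤ R)
    (hρ : Integrable (fun y => ‖y‖ ^ 2) ρ) : ContDiff ℝ ∞ (expNegExponent ρ) :=
  Real.contDiff_exp.comp (Complex.reCLM.contDiff.comp (contDiff_compExponent hR hρ)).neg

theorem norm_iteratedFDeriv_expNegExponent_le (hR0 : 0 ≤ R) (hR : ∀ᵐ y ∂ρ, ‖y‖ ≤ R)
    (hρ : Integrable (fun y => ‖y‖ ^ 2) ρ) (hM : ∫ y, ‖y‖ ^ 2 ∂ρ ≤ M₂) (k : ℕ) (u : E) :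
    ‖iteratedFDeriv ℝ k (expNegExponent ρ) u‖ ≤
      k.factorial * expNegExponent ρ u * ((1 + R) * (1 + M₂) * (1 + ‖u‖)) ^ k := by
  have hcd := contDiff_compExponent hR hρ
  have hf : ContDiff ℝ ∞ ((-Complex.reCLM : ℂ →L[ℝ] ℝ) ∘ compExponent ρ) :=
    (-Complex.reCLM : ℂ →L[ℝ] ℝ).contDiff.comp hcd
  refine norm_iteratedFDeriv_comp_le (g := Real.exp) (N := ∞) Real.contDiff_exp hf
    (mod_cast le_top) u (fun i _ => ?_) (fun i hi _ => ?_)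
  · rw [norm_iteratedFDeriv_eq_norm_iteratedDeriv, iteratedDeriv_eq_iterate, Real.iter_deriv_exp,
      Real.norm_of_nonneg (Real.exp_nonneg _)]
    rfl
  · refine (ContinuousLinearMap.norm_iteratedFDeriv_comp_left (N := ∞) _ hcd.contDiffAt
      (mod_cast le_top)).trans ?_
    rw [norm_neg, Complex.reCLM_norm, one_mul]
    exact norm_iteratedFDeriv_compExponent_le hR0 hR hρ hM hi u

/-- The constant precedes `ρ` in the quantifiers: it depends only on the support radius, the second
moment bound and the lower bound of the symbol. This is where uniformity in time originates. -/
theorem exists_schwartz_decay_expNegExponent {R M₂ c M α : ℝ} (hc : 0 < c) (hα : 0 < α)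
    (hR0 : 0 ≤ R) (k m : ℕ) :
    ∃ C : ℝ, 0 ≤ C ∧ ∀ ρ : Measure E, (∀ᵐ y ∂ρ, ‖y‖ ≤ R) → Integrable (fun y => ‖y‖ ^ 2) ρ →
      ∫ y, ‖y‖ ^ 2 ∂ρ ≤ M₂ →
      (∀ u : E, c * ‖u‖ ^ α - M ≤ ∫ y, (1 - Real.cos (inner ℝ u y)) ∂ρ) →
      ∀ u, ‖u‖ ^ k * ‖iteratedFDeriv ℝ m (expNegExponent ρ) u‖ ≤ C := by
  obtain ⟨C, hC0, hC⟩ := one_add_pow_mul_exp_neg_le hc hα (k + m)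
  refine ⟨m.factorial * Real.exp M * |(1 + R) * (1 + M₂)| ^ m * C, by positivity,
    fun ρ hR hρ hM hlow u => ?_⟩
  have hu := norm_nonneg u
  have hM0 : 0 ≤ M₂ := (integral_nonneg fun y => by positivity).trans hM
  have h1 : expNegExponent ρ u ≤ Real.exp M * Real.exp (-(c * ‖u‖ ^ α)) := by
    rw [expNegExponent, ← Real.exp_add, re_compExponent hρ]
    gcongr
    linarith [hlow u]
  rw [abs_of_nonneg (by positivity)]
  calc ‖u‖ ^ k * ‖iteratedFDeriv ℝ m (expNegExponent ρ) u‖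
      ≤ (1 + ‖u‖) ^ k * (m.factorial * (Real.exp M * Real.exp (-(c * ‖u‖ ^ α))) *
          ((1 + R) * (1 + M₂) * (1 + ‖u‖)) ^ m) := by
        gcongr
        · linarith
        · exact (norm_iteratedFDeriv_expNegExponent_le hR0 hR hρ hM m u).trans (by gcongr)
    _ = m.factorial * Real.exp M * ((1 + R) * (1 + M₂)) ^ m *
          ((1 + ‖u‖) ^ (k + m) * Real.exp (-(c * ‖u‖ ^ α))) := by
        rw [mul_pow ((1 + R) * (1 + M₂)), pow_add]
        generalize (1 + R) * (1 + M₂) = B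
        ring
    _ ≤ _ := by
        gcongr
        exact hC _ hu

end CompensatedExponentBounds

/-! ### Schwartz densities by Fourier inversion -/

section SchwartzDensity

open scoped ContDiff SchwartzMap FourierTransform

variable {E : Type*} [NormedAddCommGroup E] [InnerProductSpace ℝ E] [FiniteDimensional ℝ E]
  [MeasurableSpace E] [BorelSpace E]

/-- The real part of the density whose characteristic function is the given Schwartz function. -/
def densityCLM : 𝓢(E, ℂ) →L[ℝ] 𝓢(E, ℝ) :=
  SchwartzMap.postcompCLM Complex.reCLM ∘L SchwartzMap.fourierTransformCLM ℝ ∘L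
    SchwartzMap.compCLMOfContinuousLinearEquiv ℝ
      (ContinuousLinearEquiv.smulLeft (Units.mk0 (2 * Real.pi) (by positivity)))

/-- Fourier inversion, the dilation by `2π` reconciling the two normalizations. By Hermitian
symmetry of `Φ` the conjugate density has the same transform, hence so does the average of the two,
which is the real part. -/
theorem integral_exp_mul_densityCLM (Φ : 𝓢(E, ℂ)) (hΦ : ∀ u, Φ (-u) = (starRingEnd ℂ) (Φ u))
    (u : E) :
    ∫ x, Complex.exp ((inner ℝ x u : ℝ) * Complex.I) * (densityCLM Φ x : ℂ) = Φ u := by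
  set Φs : 𝓢(E, ℂ) := SchwartzMap.compCLMOfContinuousLinearEquiv ℝ
      (ContinuousLinearEquiv.smulLeft (Units.mk0 (2 * Real.pi) (by positivity))) Φ with hΦs
  have hp : ∀ v : E, ∫ x, Complex.exp ((inner ℝ x v : ℝ) * Complex.I) * (𝓕 Φs) x = Φ v := by
    intro v
    have h1 : 𝓕⁻ (𝓕 Φs) ((2 * Real.pi)⁻¹ • v) = Φ v := by
      rw [FourierTransform.fourierInv_fourier_eq]
      change Φ ((2 * Real.pi) • (2 * Real.pi)⁻¹ • v) = Φ v
      rw [smul_smul, mul_inv_cancel₀ (by positivity), one_smul]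
    rw [← h1, SchwartzMap.fourierInv_coe, Real.fourierInv_eq']
    refine integral_congr_ae (ae_of_all _ fun x => ?_)
    simp only [smul_eq_mul, inner_smul_right]
    congr 3
    push_cast
    field_simp
  have hi : ∀ v : E, Integrable fun x =>
      Complex.exp ((inner ℝ x v : ℝ) * Complex.I) * (𝓕 Φs) x := by
    intro v
    refine (SchwartzMap.integrable (𝓕 Φs)).norm.mono' (by fun_prop) (ae_of_all _ fun x => ?_)
    rw [norm_mul, Complex.norm_exp_ofReal_mul_I, one_mul]
  have hconj : ∫ x, Complex.exp ((inner ℝ x u : ℝ) * Complex.I) * (starRingEnd ℂ) ((𝓕 Φs) x)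
      = Φ u := by
    rw [← neg_neg u, hΦ (-u), ← hp (-u), ← integral_conj]
    refine integral_congr_ae (ae_of_all _ fun x => ?_)
    simp [← Complex.exp_conj]
  have hi' : Integrable fun x =>
      Complex.exp ((inner ℝ x u : ℝ) * Complex.I) * (starRingEnd ℂ) ((𝓕 Φs) x) := by
    refine (SchwartzMap.integrable (𝓕 Φs)).norm.mono'
      (by have := (𝓕 Φs).continuous; fun_prop) (ae_of_all _ fun x => ?_)
    rw [norm_mul, Complex.norm_exp_ofReal_mul_I, one_mul, RCLike.norm_conj]
  calc _ = ∫ x, (1 / 2 : ℂ) * (Complex.exp ((inner ℝ x u : ℝ) * Complex.I) * (𝓕 Φs) x +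
        Complex.exp ((inner ℝ x u : ℝ) * Complex.I) * (starRingEnd ℂ) ((𝓕 Φs) x)) := by
        refine integral_congr_ae (ae_of_all _ fun x => ?_)
        have : (densityCLM Φ x : ℂ) = (((𝓕 Φs) x).re : ℂ) := rfl
        simp only [this, Complex.re_eq_add_conj]
        ring
    _ = Φ u := by
        rw [integral_const_mul, integral_add (hi u) hi', hp u, hconj]
        ring

/-- The map from `Φ` to the gradient of its density is continuous and linear from Schwartz space to
`L¹`, so finitely many seminorms control it. This avoids any explicit estimate of the density. -/
theorem exists_seminorm_bound_fderiv_densityCLM :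
    ∃ (s : Finset (ℕ × ℕ)) (C : ℝ), 0 ≤ C ∧ ∀ Φ : 𝓢(E, ℂ),
      ∫ x, ‖fderiv ℝ (densityCLM Φ) x‖ ≤ C * (s.sup (schwartzSeminormFamily ℝ E ℂ)) Φ := by
  let T : 𝓢(E, ℂ) →L[ℝ] Lp (E →L[ℝ] ℝ) 1 (volume : Measure E) :=
    SchwartzMap.toLpCLM ℝ (E →L[ℝ] ℝ) 1 volume ∘L SchwartzMap.fderivCLM ℝ E ℝ ∘L densityCLM
  obtain ⟨s, C, -, hC⟩ := Seminorm.bound_of_continuous (schwartz_withSeminorms ℝ E ℂ)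
    ((normSeminorm ℝ (Lp (E →L[ℝ] ℝ) 1 (volume : Measure E))).comp T.toLinearMap)
    (by exact T.continuous.norm)
  refine ⟨s, C, C.2, fun Φ => ?_⟩
  have h1 : ‖T Φ‖ ≤ C * (s.sup (schwartzSeminormFamily ℝ E ℂ)) Φ := hC Φ
  have h2 : ‖T Φ‖ = ∫ x, ‖fderiv ℝ (densityCLM Φ) x‖ := SchwartzMap.norm_toLp_one
  rwa [← h2]

theorem exists_schwartz_density {R M₂ c M α : ℝ} (hc : 0 < c) (hα : 0 < α) (hR0 : 0 ≤ R) :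
    ∃ K : ℝ, 0 ≤ K ∧ ∀ ρ : Measure E, (∀ᵐ y ∂ρ, ‖y‖ ≤ R) → Integrable (fun y => ‖y‖ ^ 2) ρ →
      ∫ y, ‖y‖ ^ 2 ∂ρ ≤ M₂ →
      (∀ u : E, c * ‖u‖ ^ α - M ≤ ∫ y, (1 - Real.cos (inner ℝ u y)) ∂ρ) →
      ∃ q : 𝓢(E, ℝ), (∀ u : E, ∫ x, Complex.exp ((inner ℝ x u : ℝ) * Complex.I) * (q x : ℂ) =
          Complex.exp (-(∫ y, (1 - Real.cos (inner ℝ u y)) ∂ρ : ℝ))) ∧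
        ∫ x, ‖fderiv ℝ q x‖ ≤ K := by
  obtain ⟨s, C, hC0, hC⟩ := exists_seminorm_bound_fderiv_densityCLM (E := E)
  choose D hD0 hD using fun k m : ℕ =>
    exists_schwartz_decay_expNegExponent (E := E) (M₂ := M₂) (M := M) hc hα hR0 k m
  refine ⟨C * ∑ i ∈ s, D i.1 i.2, mul_nonneg hC0 (Finset.sum_nonneg fun i _ => hD0 _ _),
    fun ρ hR hρ hM hlow => ?_⟩
  have hcd := contDiff_expNegExponent hR hρ
  have hdec : ∀ (k m : ℕ) (u : E),
      ‖u‖ ^ k * ‖iteratedFDeriv ℝ m (fun u => (expNegExponent ρ u : ℂ)) u‖ ≤ D k m := by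
    intro k m u
    have := Complex.ofRealLI.norm_iteratedFDeriv_comp_left (n := ∞) (i := m)
      (hcd.contDiffAt (x := u)) (mod_cast le_top)
    change ‖iteratedFDeriv ℝ m (fun u => (expNegExponent ρ u : ℂ)) u‖ = _ at this
    rw [this]
    exact hD k m ρ hR hρ hM hlow u
  let Φ : 𝓢(E, ℂ) := ⟨fun u => (expNegExponent ρ u : ℂ), Complex.ofRealCLM.contDiff.comp hcd,
    fun k m => ⟨D k m, hdec k m⟩⟩
  have hΦ : ∀ u, Φ u = Complex.exp (-(∫ y, (1 - Real.cos (inner ℝ u y)) ∂ρ : ℝ)) := by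
    intro u
    change ((expNegExponent ρ u : ℝ) : ℂ) = _
    rw [expNegExponent, re_compExponent hρ]
    push_cast
    rfl
  refine ⟨densityCLM Φ, fun u => ?_, ?_⟩
  · rw [integral_exp_mul_densityCLM Φ ?_ u, hΦ]
    intro v
    change ((expNegExponent ρ (-v) : ℝ) : ℂ) = (starRingEnd ℂ) ((expNegExponent ρ v : ℝ) : ℂ)
    rw [Complex.conj_ofReal, expNegExponent, expNegExponent, re_compExponent hρ,
      re_compExponent hρ]
    simp
  · refine (hC Φ).trans (mul_le_mul_of_nonneg_left ?_ hC0)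
    refine Seminorm.finset_sup_apply_le (Finset.sum_nonneg fun i _ => hD0 _ _) fun i hi => ?_
    refine le_trans ?_ (Finset.single_le_sum (f := fun i : ℕ × ℕ => D i.1 i.2)
      (fun i _ => hD0 _ _) hi)
    exact SchwartzMap.seminorm_le_bound ℝ i.1 i.2 Φ (hD0 _ _) (hdec i.1 i.2)

end SchwartzDensity

/-! ### Gradient estimate for laws of the form `q * m` -/

section DensityConvolution

open scoped SchwartzMap

variable {E : Type*} [NormedAddCommGroup E] [InnerProductSpace ℝ E] [FiniteDimensional ℝ E]
  [MeasurableSpace E] [BorelSpace E]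

/-- Positivity of `q` is never established; the positive and negative parts are treated as two
separate measures. -/
theorem integral_withDensity_ofReal_sub {F : Type*} [NormedAddCommGroup F] [NormedSpace ℝ F]
    {q : E → ℝ} (hq : Measurable q) {g : E → F} (hg : Integrable (fun x => q x • g x)) :
    ∫ x, g x ∂(volume.withDensity fun x => ENNReal.ofReal (q x)) -
      ∫ x, g x ∂(volume.withDensity fun x => ENNReal.ofReal (-q x)) = ∫ x, q x • g x := by
  rw [integral_withDensity_eq_integral_toReal_smul (by fun_prop) (by simp),
    integral_withDensity_eq_integral_toReal_smul (by fun_prop) (by simp)]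
  have h : ∀ x, (ENNReal.ofReal (q x)).toReal • g x = (Set.indicator {x | 0 ≤ q x}
      (fun x => q x • g x)) x := by
    intro x
    by_cases hx : 0 ≤ q x
    · simp [hx]
    · simp [hx, ENNReal.ofReal_of_nonpos (not_le.1 hx).le]
  have h' : ∀ x, (ENNReal.ofReal (-q x)).toReal • g x = -(Set.indicator {x | 0 ≤ q x}ᶜ
      (fun x => q x • g x)) x := by
    intro x
    by_cases hx : 0 ≤ q x
    · simp [hx, ENNReal.ofReal_of_nonpos (neg_nonpos.2 hx)]
    · simp [hx, ENNReal.toReal_ofReal (neg_nonneg.2 (not_le.1 hx).le)]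
  have hs : MeasurableSet {x | 0 ≤ q x} := measurableSet_le measurable_const hq
  simp_rw [h, h']
  rw [integral_neg, sub_neg_eq_add, ← integral_add (hg.indicator hs) (hg.indicator hs.compl)]
  simp_rw [Set.indicator_self_add_compl_apply]

/-- The identity `L = q * m` with the negative part of `q` moved to the left: both sides are then
finite positive measures, and uniqueness of characteristic functions applies. -/
theorem add_conv_eq_conv_of_charFun {L m : Measure E} [IsProbabilityMeasure L]
    [IsProbabilityMeasure m] (q : 𝓢(E, ℝ))
    (h : ∀ u, charFun L u =
      (∫ x, Complex.exp ((inner ℝ x u : ℝ) * Complex.I) * (q x : ℂ)) * charFun m u) :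
    L + (volume.withDensity fun x => ENNReal.ofReal (-q x)).conv m =
      (volume.withDensity fun x => ENNReal.ofReal (q x)).conv m := by
  have := isFiniteMeasure_withDensity_ofReal (SchwartzMap.integrable (μ := volume) q).2
  have : IsFiniteMeasure (volume.withDensity fun x => ENNReal.ofReal (-q x)) :=
    isFiniteMeasure_withDensity_ofReal (SchwartzMap.integrable (μ := volume) q).neg.2
  have hi : ∀ (u : E) (μ : Measure E) [IsFiniteMeasure μ],
      Integrable (fun x => Complex.exp ((inner ℝ x u : ℝ) * Complex.I)) μ := by
    intro u μ _
    refine (integrable_const (1 : ℝ)).mono' (by fun_prop) (ae_of_all _ fun x => ?_)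
    rw [Complex.norm_exp_ofReal_mul_I]
  refine Measure.ext_of_charFun (funext fun u => ?_)
  have hiq : Integrable (fun x => q x • Complex.exp ((inner ℝ x u : ℝ) * Complex.I)) := by
    refine (SchwartzMap.integrable q).norm.mono'
      (by have := q.continuous; fun_prop) (ae_of_all _ fun x => ?_)
    rw [norm_smul, Complex.norm_exp_ofReal_mul_I, mul_one]
  have h1 := integral_withDensity_ofReal_sub q.continuous.measurable hiq
  rw [charFun_apply, integral_add_measure (hi u _) (hi u _), ← charFun_apply, ← charFun_apply,
    charFun_conv, charFun_conv, h u, ← add_mul]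
  congr 1
  rw [charFun_apply, charFun_apply, ← eq_sub_iff_add_eq, h1]
  refine integral_congr_ae (ae_of_all _ fun x => ?_)
  simp [mul_comm]

theorem integrable_of_abs_le {μ : Measure E} [IsFiniteMeasure μ] {f : E → ℝ} (hf : Measurable f)
    {B : ℝ} (hB : ∀ x, |f x| ≤ B) : Integrable f μ :=
  (integrable_const B).mono' hf.aestronglyMeasurable (ae_of_all _ hB)

theorem measurable_integral_add {m : Measure E} [SFinite m] {f : E → ℝ} (hf : Measurable f) :
    Measurable fun w => ∫ b, f (w + b) ∂m := by
  have : StronglyMeasurable (Function.uncurry fun w b : E => f (w + b)) :=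
    (hf.comp measurable_add).stronglyMeasurable
  exact this.integral_prod_right.measurable

theorem abs_integral_add_le {m : Measure E} [IsProbabilityMeasure m] {f : E → ℝ}
    {B : ℝ} (hB : ∀ x, |f x| ≤ B) (w : E) : |∫ b, f (w + b) ∂m| ≤ B := by
  simpa using norm_integral_le_of_norm_le_const (μ := m) (f := fun b => f (w + b)) (C := B)
    (ae_of_all _ fun b => hB (w + b))

/-- Translation invariance of Lebesgue measure moves `z` from `f`, which is only measurable, to the
smooth `q`. -/
theorem integral_add_eq_integral_density {L m : Measure E} [IsProbabilityMeasure L]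
    [IsProbabilityMeasure m] (q : 𝓢(E, ℝ))
    (h : ∀ u, charFun L u =
      (∫ x, Complex.exp ((inner ℝ x u : ℝ) * Complex.I) * (q x : ℂ)) * charFun m u)
    {f : E → ℝ} (hf : Measurable f) {B : ℝ} (hB : ∀ x, |f x| ≤ B) (z : E) :
    ∫ y, f (z + y) ∂L = ∫ w, q (w - z) * ∫ b, f (w + b) ∂m := by
  have := isFiniteMeasure_withDensity_ofReal (SchwartzMap.integrable (μ := volume) q).2
  have : IsFiniteMeasure (volume.withDensity fun x => ENNReal.ofReal (-q x)) :=
    isFiniteMeasure_withDensity_ofReal (SchwartzMap.integrable (μ := volume) q).neg.2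
  have hfz : Measurable fun y => f (z + y) := by fun_prop
  have hBz : ∀ y, |f (z + y)| ≤ B := fun y => hB _
  have h1 := congrArg (fun μ : Measure E => ∫ y, f (z + y) ∂μ) (add_conv_eq_conv_of_charFun q h)
  rw [integral_add_measure (integrable_of_abs_le hfz hBz) (integrable_of_abs_le hfz hBz),
    integral_conv (integrable_of_abs_le hfz hBz), integral_conv (integrable_of_abs_le hfz hBz),
    ← eq_sub_iff_add_eq, integral_withDensity_ofReal_sub q.continuous.measurable] at h1
  · rw [h1, ← integral_add_left_eq_self (fun w => q (w - z) * ∫ b, f (w + b) ∂m) z]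
    simp [add_assoc]
  · simp_rw [← add_assoc]
    refine ((SchwartzMap.integrable q).norm.mul_const B).mono' ?_ (ae_of_all _ fun x => ?_)
    · exact (q.continuous.measurable.smul
        ((measurable_integral_add hf).comp (measurable_const_add z))).aestronglyMeasurable
    · rw [norm_smul]
      gcongr
      exact abs_integral_add_le hB _

theorem exists_norm_fderiv_schwartz_le (q : 𝓢(E, ℝ)) (N : ℕ) :
    ∃ C : ℝ, 0 ≤ C ∧ ∀ x, ‖fderiv ℝ q x‖ ≤ C * (1 + ‖x‖) ^ (-(N : ℝ)) := by
  refine ⟨2 ^ N * ((Finset.Iic (N, 1)).sup fun m => SchwartzMap.seminorm ℝ m.1 m.2) q,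
    by positivity, fun x => ?_⟩
  have := SchwartzMap.one_add_le_sup_seminorm_apply (𝕜 := ℝ) (m := (N, 1)) (k := N) (n := 1)
    le_rfl le_rfl q x
  rw [← norm_iteratedFDeriv_fderiv, norm_iteratedFDeriv_zero] at this
  rw [Real.rpow_neg (by positivity), Real.rpow_natCast, ← div_eq_mul_inv,
    le_div_iff₀ (by positivity), mul_comm]
  exact this

theorem hasFDerivAt_integral_schwartz_mul (q : 𝓢(E, ℝ)) {F : E → ℝ} (hF : Measurable F) {B : ℝ}
    (hB : ∀ x, |F x| ≤ B) (z : E) :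
    HasFDerivAt (fun z => ∫ w, q (w - z) * F w) (∫ w, -(F w • fderiv ℝ q (w - z))) z := by
  -- One more than the dimension, so that `(1 + ‖x‖) ^ (-N)` is integrable.
  set N := Module.finrank ℝ E + 1
  obtain ⟨C, hC0, hC⟩ := exists_norm_fderiv_schwartz_le q N
  have hB0 : 0 ≤ B := (abs_nonneg _).trans (hB 0)
  have hm : ∀ z : E, AEStronglyMeasurable (fun w => q (w - z) * F w) := by
    intro z
    have := q.continuous.measurable
    exact (by fun_prop : Measurable fun w => q (w - z) * F w).aestronglyMeasurable
  have hq' : Continuous (fderiv ℝ q) := (q.smooth 1).continuous_fderiv one_ne_zero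
  refine hasFDerivAt_integral_of_dominated_of_fderiv_le (μ := volume)
    (F := fun z w => q (w - z) * F w) (F' := fun z w => -(F w • fderiv ℝ q (w - z)))
    (Metric.ball_mem_nhds z one_pos) (Eventually.of_forall hm)
    ?_ ?_ (bound := fun w => B * (C * 2 ^ N) * (1 + ‖w - z‖) ^ (-(N : ℝ)))
    (ae_of_all _ fun w v hv => ?_) ?_ (ae_of_all _ fun w v _ => ?_)
  · refine (((SchwartzMap.integrable q).comp_sub_right z).norm.mul_const B).mono' (hm z)
      (ae_of_all _ fun w => ?_)
    rw [norm_mul]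
    gcongr
    exact hB w
  · exact (hF.aestronglyMeasurable.smul
      (hq'.comp (continuous_id.sub continuous_const)).aestronglyMeasurable).neg
  · rw [norm_neg, norm_smul, mul_assoc, mul_assoc]
    gcongr
    · exact hB w
    · refine (hC _).trans ?_
      gcongr
      have hv' : ‖v - z‖ < 1 := by simpa [dist_eq_norm] using hv
      have h1 : ‖w - z‖ ≤ ‖w - v‖ + ‖v - z‖ := by
        simpa using norm_add_le (w - v) (v - z)
      -- Replacing the centre `v` by `z` costs a factor 2 inside the power: this is the `2 ^ N` in
      -- the dominating function.
      have h2 : 1 + ‖w - z‖ ≤ 2 * (1 + ‖w - v‖) := by linarith [norm_nonneg (w - v)]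
      rw [Real.rpow_neg (by positivity), Real.rpow_neg (by positivity), Real.rpow_natCast,
        Real.rpow_natCast, ← div_eq_mul_inv, le_div_iff₀ (by positivity),
        inv_mul_le_iff₀ (by positivity), ← mul_pow, mul_comm _ (2 : ℝ)]
      gcongr
  · exact ((integrable_one_add_norm (by simp [N])).comp_sub_right z).const_mul _
  · have h1 : HasFDerivAt (fun z => q (w - z)) (-(fderiv ℝ q (w - v))) v := by
      have := (q.differentiableAt (x := w - v)).hasFDerivAt.comp v
        ((hasFDerivAt_id v).const_sub w)
      exact this.congr_fderiv (by ext; simp)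
    have := h1.mul_const (F w)
    simpa using this

theorem gradient_estimate_of_charFun {L m : Measure E} [IsProbabilityMeasure L]
    [IsProbabilityMeasure m] (q : 𝓢(E, ℝ))
    (h : ∀ u, charFun L u =
      (∫ x, Complex.exp ((inner ℝ x u : ℝ) * Complex.I) * (q x : ℂ)) * charFun m u)
    {f : E → ℝ} (hf : Measurable f) {B : ℝ} (hB : ∀ x, |f x| ≤ B) :
    Differentiable ℝ (fun z => ∫ y, f (z + y) ∂L) ∧
      ∀ z, ‖fderiv ℝ (fun z => ∫ y, f (z + y) ∂L) z‖ ≤ (∫ x, ‖fderiv ℝ q x‖) * B := by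
  have hd := hasFDerivAt_integral_schwartz_mul q (measurable_integral_add (m := m) hf)
    (abs_integral_add_le hB)
  simp_rw [integral_add_eq_integral_density q h hf hB]
  refine ⟨fun z => (hd z).differentiableAt, fun z => ?_⟩
  rw [(hd z).fderiv, ← integral_sub_right_eq_self (fun x => ‖fderiv ℝ q x‖) z, ← integral_mul_const]
  refine norm_integral_le_of_norm_le ?_ (ae_of_all _ fun w => ?_)
  · exact (((SchwartzMap.fderivCLM ℝ E ℝ q).integrable).norm.comp_sub_right z).mul_const B
  · rw [norm_neg, norm_smul, mul_comm]
    gcongr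
    exact abs_integral_add_le hB w

end DensityConvolution

/-! ### Symmetric Lévy measures and their real symbols -/

section SymmetricLevyMeasure

variable {E : Type*} [NormedAddCommGroup E] [InnerProductSpace ℝ E] [FiniteDimensional ℝ E]
  [MeasurableSpace E] [BorelSpace E]

/-- A symmetric Lévy measure: it integrates `|y|²` near the origin, is finite away from the origin,
and is invariant under `y ↦ -y`. -/
structure IsSymmLevyMeasure (ν : Measure E) : Prop where
  sFinite : SFinite ν
  integrable_sq : Integrable (fun y => ‖y‖ ^ 2) (ν.restrict (Metric.closedBall 0 1))
  finite_compl : ν (Metric.closedBall 0 1)ᶜ < ∞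
  symm : ν.map (fun y => -y) = ν

/-- The Lévy symbol `∫ (1 - cos ⟨u, y⟩) ν(dy)` of a symmetric Lévy measure. -/
def symbol (ν : Measure E) (u : E) : ℝ :=
  ∫ y, (1 - Real.cos (inner ℝ u y)) ∂ν

theorem one_sub_cos_inner_nonneg (u y : E) : 0 ≤ 1 - Real.cos (inner ℝ u y) := by
  linarith [Real.cos_le_one (inner ℝ u y)]

theorem one_sub_cos_inner_le_two (u y : E) : 1 - Real.cos (inner ℝ u y) ≤ 2 := by
  linarith [Real.neg_one_le_cos (inner ℝ u y)]

theorem one_sub_cos_inner_le_sq (u y : E) :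
    1 - Real.cos (inner ℝ u y) ≤ ‖u‖ ^ 2 * ‖y‖ ^ 2 := by
  have h1 := Real.one_sub_sq_div_two_le_cos (x := inner ℝ u y)
  have h2 := abs_real_inner_le_norm u y
  have h3 : (inner ℝ u y : ℝ) ^ 2 ≤ (‖u‖ * ‖y‖) ^ 2 := by
    rw [← sq_abs]
    gcongr
  nlinarith [sq_nonneg (‖u‖ * ‖y‖)]

theorem integrable_one_sub_cos_of_sq {ρ : Measure E} (hρ : Integrable (fun y => ‖y‖ ^ 2) ρ)
    (u : E) : Integrable (fun y => 1 - Real.cos (inner ℝ u y)) ρ :=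
  (hρ.const_mul (‖u‖ ^ 2)).mono' (by fun_prop) (ae_of_all _ fun y => by
    rw [Real.norm_of_nonneg (one_sub_cos_inner_nonneg u y)]
    exact one_sub_cos_inner_le_sq u y)

theorem integrable_one_sub_cos_of_finite (ρ : Measure E) [IsFiniteMeasure ρ] (u : E) :
    Integrable (fun y => 1 - Real.cos (inner ℝ u y)) ρ :=
  (integrable_const 2).mono' (by fun_prop) (ae_of_all _ fun y => by
    rw [Real.norm_of_nonneg (one_sub_cos_inner_nonneg u y)]
    exact one_sub_cos_inner_le_two u y)

/-- Symmetry makes the characteristic function equal to its conjugate, so only the cosine part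
survives. It puts the compound Poisson exponent in terms of `symbol`. -/
theorem integral_exp_inner_sub_one_of_symm {ρ : Measure E} [IsFiniteMeasure ρ]
    (h : ρ.map (fun y => -y) = ρ) (u : E) :
    charFun ρ u - ρ.real Set.univ = -(symbol ρ u : ℂ) := by
  have hc : charFun ρ (-u) = charFun ρ u := by
    conv_rhs => rw [← h]
    rw [charFun_apply, charFun_apply, integral_map (by fun_prop) (by fun_prop)]
    simp
  have hi : Integrable (fun x => Complex.exp ((inner ℝ x u : ℝ) * Complex.I)) ρ := by
    refine (integrable_const (1 : ℝ)).mono' (by fun_prop) (ae_of_all _ fun x => ?_)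
    rw [Complex.norm_exp_ofReal_mul_I]
  have him : (charFun ρ u).im = 0 := by
    rw [charFun_neg] at hc
    exact Complex.conj_eq_iff_im.1 hc
  have hre : (charFun ρ u).re = ∫ y, Real.cos (inner ℝ u y) ∂ρ := by
    rw [charFun_apply, ← RCLike.re_eq_complex_re, ← integral_re hi]
    refine integral_congr_ae (ae_of_all _ fun y => ?_)
    simp [Complex.exp_ofReal_mul_I_re, real_inner_comm]
  have hcos : Integrable (fun y => Real.cos (inner ℝ u y)) ρ :=
    (integrable_const (1 : ℝ)).mono' (by fun_prop)
      (ae_of_all _ fun y => Real.abs_cos_le_one _)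
  rw [symbol, integral_sub (integrable_const _) hcos, ← hre]
  apply Complex.ext <;> simp [him]

variable {ν : Measure E}

theorem IsSymmLevyMeasure.isFiniteMeasure (hν : IsSymmLevyMeasure ν) :
    IsFiniteMeasure (ν.restrict (Metric.closedBall 0 1)ᶜ) :=
  ⟨by simpa using hν.finite_compl⟩

theorem IsSymmLevyMeasure.integrable_one_sub_cos (hν : IsSymmLevyMeasure ν) (u : E) :
    Integrable (fun y => 1 - Real.cos (inner ℝ u y)) ν := by
  have := hν.isFiniteMeasure
  rw [← integrableOn_univ, ← Set.union_compl_self (Metric.closedBall (0 : E) 1)]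
  exact IntegrableOn.union (integrable_one_sub_cos_of_sq hν.integrable_sq u)
    (integrable_one_sub_cos_of_finite _ u)

theorem IsSymmLevyMeasure.symbol_eq_add (hν : IsSymmLevyMeasure ν) (u : E) :
    symbol ν u = symbol (ν.restrict (Metric.closedBall 0 1)) u +
      symbol (ν.restrict (Metric.closedBall 0 1)ᶜ) u :=
  (integral_add_compl Metric.isClosed_closedBall.measurableSet (hν.integrable_one_sub_cos u)).symm

theorem IsSymmLevyMeasure.symm_restrict_compl (hν : IsSymmLevyMeasure ν) :
    (ν.restrict (Metric.closedBall 0 1)ᶜ).map (fun y => -y) =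
      ν.restrict (Metric.closedBall 0 1)ᶜ := by
  have h : MeasurePreserving (fun y : E => -y) ν ν := ⟨measurable_neg, hν.symm⟩
  have := (h.restrict_preimage (s := (Metric.closedBall 0 1)ᶜ)
    Metric.isClosed_closedBall.measurableSet.compl).map_eq
  convert this using 3
  ext y
  simp

theorem symbol_le_of_finite (ρ : Measure E) [IsFiniteMeasure ρ] (u : E) :
    symbol ρ u ≤ 2 * ρ.real Set.univ := by
  calc symbol ρ u ≤ ∫ _, 2 ∂ρ :=
        integral_mono (integrable_one_sub_cos_of_finite ρ u) (integrable_const _)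
          (one_sub_cos_inner_le_two u)
    _ = _ := by simp [mul_comm]

theorem continuous_symbol_of_sq {ρ : Measure E} (hρ : Integrable (fun y => ‖y‖ ^ 2) ρ) :
    Continuous (symbol ρ) := by
  have h : symbol ρ = fun u => (compExponent ρ u).re := funext fun u => (re_compExponent hρ u).symm
  rw [h]
  exact Complex.continuous_re.comp
    (continuous_iff_continuousAt.2 fun u => (hasFDerivAt_compExponent hρ u).continuousAt)

theorem continuous_symbol_of_finite (ρ : Measure E) [IsFiniteMeasure ρ] :
    Continuous (symbol ρ) :=
  continuous_of_dominated (bound := fun _ => 2) (fun u => by fun_prop)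
    (fun u => ae_of_all _ fun y => by
      rw [Real.norm_of_nonneg (one_sub_cos_inner_nonneg u y)]
      exact one_sub_cos_inner_le_two u y)
    (integrable_const _) (ae_of_all _ fun y => by fun_prop)

theorem IsSymmLevyMeasure.continuous_symbol (hν : IsSymmLevyMeasure ν) :
    Continuous (symbol ν) := by
  have := hν.isFiniteMeasure
  rw [funext hν.symbol_eq_add]
  exact (continuous_symbol_of_sq hν.integrable_sq).add (continuous_symbol_of_finite _)

end SymmetricLevyMeasure

/-! ### The complex Lévy exponent of a symmetric measure is its symbol -/

section LevyExponent

variable {n : ℕ} {ν : Measure (EuclideanSpace ℝ (Fin n))}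

/-- Add the integrand at `y` and at `-y`: the truncated compensator is odd and cancels, and the
exponentials combine to a cosine. -/
theorem IsSymmLevyMeasure.levyExponent_eq (hν : IsSymmLevyMeasure ν)
    (u : EuclideanSpace ℝ (Fin n)) : levyExponent ν u = (symbol ν u : ℂ) := by
  set g : EuclideanSpace ℝ (Fin n) → ℂ := fun y =>
    Complex.exp (Complex.I * (inner ℝ u y : ℝ)) - 1
    - (Metric.closedBall (0 : EuclideanSpace ℝ (Fin n)) 1).indicator
        (fun y => Complex.I * (inner ℝ u y : ℝ)) y with hg
  have hB : MeasurableSet (Metric.closedBall (0 : EuclideanSpace ℝ (Fin n)) 1) :=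
    Metric.isClosed_closedBall.measurableSet
  have hgm : Measurable g := by
    refine Measurable.sub (by fun_prop) (Measurable.indicator (by fun_prop) hB)
  have hgi : Integrable g ν := by
    have := hν.isFiniteMeasure
    rw [← integrableOn_univ, ← Set.union_compl_self (Metric.closedBall _ 1)]
    refine IntegrableOn.union ?_ ?_
    · refine (integrable_one_add_sub_exp hν.integrable_sq u).neg.congr ?_
      filter_upwards [ae_restrict_mem hB] with y hy
      simp only [hg, Set.indicator_of_mem hy, Pi.neg_apply, imInner_apply, real_inner_comm u y]
      rw [mul_comm Complex.I]
      ring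
    · refine (integrable_const (2 : ℝ)).mono' hgm.aestronglyMeasurable ?_
      filter_upwards [ae_restrict_mem hB.compl] with y hy
      simp only [hg, Set.indicator_of_notMem hy, sub_zero]
      refine (norm_sub_le _ _).trans ?_
      rw [mul_comm, Complex.norm_exp_ofReal_mul_I, norm_one]
      norm_num
  have hgn : ∫ y, g (-y) ∂ν = ∫ y, g y ∂ν := by
    conv_rhs => rw [← hν.symm]
    rw [integral_map (by fun_prop) hgm.aestronglyMeasurable]
  have hgni : Integrable (fun y => g (-y)) ν := by
    have : Integrable g (ν.map fun y => -y) := by rwa [hν.symm]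
    exact this.comp_measurable measurable_neg
  have hsum : ∀ y, g y + g (-y) = -2 * ((1 - Real.cos (inner ℝ u y) : ℝ) : ℂ) := by
    intro y
    have h1 : (Metric.closedBall (0 : EuclideanSpace ℝ (Fin n)) 1).indicator
        (fun y => Complex.I * (inner ℝ u y : ℝ)) (-y) =
        -(Metric.closedBall (0 : EuclideanSpace ℝ (Fin n)) 1).indicator
        (fun y => Complex.I * (inner ℝ u y : ℝ)) y := by
      by_cases hy : y ∈ Metric.closedBall (0 : EuclideanSpace ℝ (Fin n)) 1
      · have hy' : -y ∈ Metric.closedBall (0 : EuclideanSpace ℝ (Fin n)) 1 := by simpa using hy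
        simp [Set.indicator_of_mem hy, Set.indicator_of_mem hy']
      · have hy' : -y ∉ Metric.closedBall (0 : EuclideanSpace ℝ (Fin n)) 1 := by simpa using hy
        simp [Set.indicator_of_notMem hy, Set.indicator_of_notMem hy']
    simp only [hg, h1, inner_neg_right]
    push_cast
    rw [Complex.cos]
    ring_nf
  have h2 : (2 : ℂ) * ∫ y, g y ∂ν = -2 * (symbol ν u : ℂ) := by
    rw [two_mul]
    nth_rewrite 2 [← hgn]
    rw [← integral_add hgi hgni]
    simp_rw [hsum]
    rw [integral_const_mul, integral_complex_ofReal, symbol]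
  rw [levyExponent]
  linear_combination (-1 / 2 : ℂ) * h2

end LevyExponent

/-! ### Stable Lévy measures: integrability, symmetry and scaling -/

section StableMeasure

variable {n : ℕ} {α : ℝ} {μ : Measure (EuclideanSpace ℝ (Fin n))}

/-- The radial part `dr / r^(1+α)` of a stable Lévy measure. -/
def radialMeasure (α : ℝ) : Measure ℝ :=
  (volume.restrict (Set.Ioi (0 : ℝ))).withDensity (fun r : ℝ => ENNReal.ofReal (1 / r ^ (1 + α)))

instance sFinite_radialMeasure (α : ℝ) : SFinite (radialMeasure α) := by
  unfold radialMeasure; infer_instance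

theorem stableLevyMeasure_eq (α : ℝ) (μ : Measure (EuclideanSpace ℝ (Fin n))) :
    stableLevyMeasure α μ = (μ.prod (radialMeasure α)).map
      (fun p : EuclideanSpace ℝ (Fin n) × ℝ => p.2 • p.1) := rfl

theorem lintegral_stableLevyMeasure [SFinite μ] {g : EuclideanSpace ℝ (Fin n) → ℝ≥0∞}
    (hg : Measurable g) :
    ∫⁻ y, g y ∂stableLevyMeasure α μ =
      ∫⁻ ξ, (∫⁻ r in Set.Ioi (0 : ℝ), ENNReal.ofReal (1 / r ^ (1 + α)) * g (r • ξ)) ∂μ := by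
  rw [stableLevyMeasure_eq, lintegral_map hg (by fun_prop), lintegral_prod _ (by fun_prop)]
  refine lintegral_congr fun ξ => ?_
  rw [radialMeasure, lintegral_withDensity_eq_lintegral_mul _ (by fun_prop) (by fun_prop)]
  rfl

/-- Near zero the integrand is `r ^ (1 - α)`, integrable because `α < 2`; at infinity it is `r ^
(-(1 + α))`, integrable because `α > 0`. -/
theorem lintegral_radial_min_sq_lt_top (hα0 : 0 < α) (hα2 : α < 2) :
    ∫⁻ r in Set.Ioi (0 : ℝ), ENNReal.ofReal (1 / r ^ (1 + α)) * ENNReal.ofReal (min 1 (r ^ 2))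
      < ∞ := by
  have h1 : IntegrableOn (fun r : ℝ => 1 / r ^ (1 + α) * min 1 (r ^ 2)) (Set.Ioi 0) := by
    rw [← Set.Ioc_union_Ioi_eq_Ioi zero_le_one]
    refine IntegrableOn.union ?_ ?_
    · have := (intervalIntegral.intervalIntegrable_rpow' (a := 0) (b := 1)
        (r := 1 - α) (by linarith)).1
      refine this.congr_fun (fun r hr => ?_) measurableSet_Ioc
      have : r ^ 2 ≤ 1 := pow_le_one₀ hr.1.le hr.2
      simp only [min_eq_right this]
      rw [← Real.rpow_natCast, one_div, ← Real.rpow_neg hr.1.le, ← Real.rpow_add hr.1]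
      congr 1
      push_cast
      ring
    · have := integrableOn_Ioi_rpow_of_lt (a := -(1 + α)) (by linarith) zero_lt_one
      refine this.congr_fun (fun r hr => ?_) measurableSet_Ioi
      have hr' : (1 : ℝ) < r := hr
      have : 1 ≤ r ^ 2 := one_le_pow₀ hr'.le
      simp only [min_eq_left this, mul_one]
      rw [Real.rpow_neg (by linarith), one_div]
  have h2 := h1.2
  rw [hasFiniteIntegral_iff_norm] at h2
  refine lt_of_eq_of_lt ?_ h2
  refine setLIntegral_congr_fun measurableSet_Ioi fun r hr => ?_
  have hr' : (0 : ℝ) < r := hr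
  rw [Real.norm_of_nonneg (by positivity), ENNReal.ofReal_mul (by positivity)]

theorem lintegral_min_sq_stableLevyMeasure_lt_top [IsFiniteMeasure μ] (hα0 : 0 < α) (hα2 : α < 2)
    (hμ : μ (Metric.sphere 0 1)ᶜ = 0) :
    ∫⁻ y, ENNReal.ofReal (min 1 (‖y‖ ^ 2)) ∂stableLevyMeasure α μ < ∞ := by
  rw [lintegral_stableLevyMeasure (by fun_prop)]
  have h : ∀ᵐ ξ ∂μ, (∫⁻ r in Set.Ioi (0 : ℝ), ENNReal.ofReal (1 / r ^ (1 + α)) *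
      ENNReal.ofReal (min 1 (‖r • ξ‖ ^ 2))) = ∫⁻ r in Set.Ioi (0 : ℝ),
        ENNReal.ofReal (1 / r ^ (1 + α)) * ENNReal.ofReal (min 1 (r ^ 2)) := by
    have : ∀ᵐ ξ ∂μ, ξ ∈ Metric.sphere (0 : EuclideanSpace ℝ (Fin n)) 1 := hμ
    filter_upwards [this] with ξ hξ
    have hξ' : ‖ξ‖ = 1 := by simpa using hξ
    simp [norm_smul, hξ']
  rw [lintegral_congr_ae h, lintegral_const]
  exact ENNReal.mul_lt_top (lintegral_radial_min_sq_lt_top hα0 hα2) (measure_lt_top μ _)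

theorem isSymmLevyMeasure_stableLevyMeasure [IsFiniteMeasure μ] (hα0 : 0 < α) (hα2 : α < 2)
    (hμ : μ (Metric.sphere 0 1)ᶜ = 0) (hμs : μ.map (fun ξ => -ξ) = μ) :
    IsSymmLevyMeasure (stableLevyMeasure α μ) := by
  have hfin := lintegral_min_sq_stableLevyMeasure_lt_top hα0 hα2 hμ
  have hB : MeasurableSet (Metric.closedBall (0 : EuclideanSpace ℝ (Fin n)) 1) :=
    Metric.isClosed_closedBall.measurableSet
  refine ⟨by rw [stableLevyMeasure_eq]; infer_instance, ⟨by fun_prop, ?_⟩, ?_, ?_⟩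
  · rw [hasFiniteIntegral_iff_norm]
    refine lt_of_le_of_lt ?_ hfin
    refine le_trans ?_ (setLIntegral_le_lintegral (Metric.closedBall 0 1) _)
    refine setLIntegral_mono' hB fun y hy => ?_
    have hy' : ‖y‖ ≤ 1 := by simpa using hy
    rw [Real.norm_of_nonneg (by positivity), min_eq_right (pow_le_one₀ (norm_nonneg y) hy')]
  · refine lt_of_le_of_lt ?_ hfin
    refine le_trans ?_ (setLIntegral_le_lintegral (Metric.closedBall 0 1)ᶜ _)
    rw [← setLIntegral_one]
    refine setLIntegral_mono' hB.compl fun y hy => ?_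
    have hy' : 1 < ‖y‖ := by simpa using hy
    rw [min_eq_left (one_le_pow₀ hy'.le), ENNReal.ofReal_one]
  · have h : (μ.prod (radialMeasure α)).map (Prod.map (fun ξ => -ξ) id) =
        μ.prod (radialMeasure α) := by
      rw [← Measure.map_prod_map _ _ measurable_neg measurable_id, hμs, Measure.map_id]
    rw [stableLevyMeasure_eq, Measure.map_map measurable_neg (by fun_prop)]
    conv_rhs => rw [← h]
    rw [Measure.map_map (by fun_prop) (by fun_prop)]
    congr 1
    ext1 p
    simp

/-- In polar coordinates, substitute `l * r` for `r` in the radial integral: the density contributes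
`l ^ (1 + α)` and the Jacobian `l⁻¹`. -/
theorem symbol_stableLevyMeasure_smul [IsFiniteMeasure μ] (hα0 : 0 < α) (hα2 : α < 2)
    (hμ : μ (Metric.sphere 0 1)ᶜ = 0) (hμs : μ.map (fun ξ => -ξ) = μ) {l : ℝ} (hl : 0 < l)
    (u : EuclideanSpace ℝ (Fin n)) :
    symbol (stableLevyMeasure α μ) (l • u) = l ^ α * symbol (stableLevyMeasure α μ) u := by
  have hν := isSymmLevyMeasure_stableLevyMeasure hα0 hα2 hμ hμs
  have key : ∀ v, symbol (stableLevyMeasure α μ) v = ∫ ξ, (∫ r in Set.Ioi (0 : ℝ),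
      1 / r ^ (1 + α) * (1 - Real.cos (r * inner ℝ v ξ))) ∂μ := by
    intro v
    have hi := hν.integrable_one_sub_cos v
    rw [stableLevyMeasure_eq] at hi
    replace hi : Integrable (fun p : EuclideanSpace ℝ (Fin n) × ℝ =>
        1 - Real.cos (inner ℝ v (p.2 • p.1))) (μ.prod (radialMeasure α)) :=
      hi.comp_measurable (by fun_prop)
    rw [symbol, stableLevyMeasure_eq, integral_map (by fun_prop) (by fun_prop),
      integral_prod _ hi]
    refine integral_congr_ae (ae_of_all _ fun ξ => ?_)
    simp only
    rw [radialMeasure, integral_withDensity_eq_integral_toReal_smul (by fun_prop) (by simp)]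
    refine setIntegral_congr_fun measurableSet_Ioi fun r hr => ?_
    have hr' : (0 : ℝ) < r := hr
    simp only [inner_smul_right, smul_eq_mul]
    rw [ENNReal.toReal_ofReal (by positivity)]
  rw [key, key, ← integral_const_mul]
  refine integral_congr_ae (ae_of_all _ fun ξ => ?_)
  simp only
  have h := integral_comp_mul_left_Ioi
    (fun r : ℝ => 1 / r ^ (1 + α) * (1 - Real.cos (r * inner ℝ u ξ))) 0 hl
  rw [mul_zero, smul_eq_mul] at h
  rw [← mul_inv_cancel_left₀ hl.ne' (∫ r in Set.Ioi (0 : ℝ),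
    1 / r ^ (1 + α) * (1 - Real.cos (r * inner ℝ u ξ))), ← h, ← mul_assoc, ← integral_const_mul]
  refine setIntegral_congr_fun measurableSet_Ioi fun r hr => ?_
  have hr' : (0 : ℝ) < r := hr
  simp only [inner_smul_left]
  rw [Real.mul_rpow hl.le hr'.le, Real.rpow_add hl, Real.rpow_one]
  have : l ^ α ≠ 0 := (Real.rpow_pos_of_pos hl α).ne'
  have h3 : r ^ (1 + α) ≠ 0 := (Real.rpow_pos_of_pos hr' _).ne'
  rw [show r * ((starRingEnd ℝ) l * inner ℝ u ξ) = l * r * inner ℝ u ξ by simp; ring]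
  field_simp

end StableMeasure

/-! ### Lévy measures averaged along a linear flow -/

section FlowMeasure

variable {E : Type*} [NormedAddCommGroup E] [InnerProductSpace ℝ E] [FiniteDimensional ℝ E]
  [MeasurableSpace E] [BorelSpace E]

/-- The average over `θ ∈ [0, 1]` of the images of `ρ` under the linear maps `G θ`. -/
def flowMeasure (ρ : Measure E) (G : ℝ → E →L[ℝ] E) : Measure E :=
  (ρ.prod (volume.restrict (Set.Icc (0 : ℝ) 1))).map (fun p => G p.2 p.1)

variable {G : ℝ → E →L[ℝ] E} {ρ : Measure E}

theorem continuous_flow (hG : Continuous G) : Continuous fun p : E × ℝ => G p.2 p.1 :=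
  (hG.comp continuous_snd).clm_apply continuous_fst

theorem continuous_adjoint_flow (hG : Continuous G) (u : E) :
    Continuous fun θ => (G θ).adjoint u :=
  ((ContinuousLinearMap.adjoint (𝕜 := ℝ) (E := E) (F := E)).continuous.comp hG).clm_apply
    continuous_const

theorem isFiniteMeasure_flowMeasure [IsFiniteMeasure ρ] : IsFiniteMeasure (flowMeasure ρ G) := by
  unfold flowMeasure; infer_instance

/-- Fubini and `⟨u, G y⟩ = ⟨G* u, y⟩`. The time-averaged exponent is thus again a symbol, so the
estimates for a single measure apply to it. -/
theorem symbol_flowMeasure [SFinite ρ] (hG : Continuous G) (u : E)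
    (hi : Integrable (fun y => 1 - Real.cos (inner ℝ u y)) (flowMeasure ρ G)) :
    symbol (flowMeasure ρ G) u = ∫ θ in Set.Icc (0 : ℝ) 1, symbol ρ ((G θ).adjoint u) := by
  have hm := (continuous_flow hG).measurable
  replace hi : Integrable (fun p : E × ℝ => 1 - Real.cos (inner ℝ u (G p.2 p.1)))
      (ρ.prod (volume.restrict (Set.Icc (0 : ℝ) 1))) := hi.comp_measurable hm
  rw [symbol, flowMeasure, integral_map hm.aemeasurable (by fun_prop), integral_prod_symm _ hi]
  simp only [symbol, ContinuousLinearMap.adjoint_inner_left]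

theorem flowMeasure_symm [SFinite ρ] (hG : Continuous G) (h : ρ.map (fun y => -y) = ρ) :
    (flowMeasure ρ G).map (fun y => -y) = flowMeasure ρ G := by
  have hm := (continuous_flow hG).measurable
  have h' : (ρ.prod (volume.restrict (Set.Icc (0 : ℝ) 1))).map (Prod.map (fun y => -y) id) =
      ρ.prod (volume.restrict (Set.Icc (0 : ℝ) 1)) := by
    rw [← Measure.map_prod_map _ _ measurable_neg measurable_id, h, Measure.map_id]
  rw [flowMeasure, Measure.map_map measurable_neg hm]
  conv_rhs => rw [← h']
  rw [Measure.map_map hm (by fun_prop)]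
  congr 1
  ext1 p
  simp

theorem ae_prod_snd_mem [SFinite ρ] :
    ∀ᵐ p ∂ρ.prod (volume.restrict (Set.Icc (0 : ℝ) 1)), p.2 ∈ Set.Icc (0 : ℝ) 1 :=
  Measure.quasiMeasurePreserving_snd.ae (ae_restrict_mem measurableSet_Icc)

theorem integrable_sq_comp_flow [SFinite ρ] (hG : Continuous G) {R : ℝ}
    (hR : ∀ θ ∈ Set.Icc (0 : ℝ) 1, ‖G θ‖ ≤ R) (hρ : Integrable (fun y => ‖y‖ ^ 2) ρ) :
    Integrable (fun p : E × ℝ => ‖G p.2 p.1‖ ^ 2)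
      (ρ.prod (volume.restrict (Set.Icc (0 : ℝ) 1))) ∧
    ∫ p, ‖G p.2 p.1‖ ^ 2 ∂ρ.prod (volume.restrict (Set.Icc (0 : ℝ) 1)) ≤
      R ^ 2 * ∫ y, ‖y‖ ^ 2 ∂ρ := by
  have hb : ∀ᵐ p ∂ρ.prod (volume.restrict (Set.Icc (0 : ℝ) 1)),
      ‖G p.2 p.1‖ ^ 2 ≤ R ^ 2 * ‖p.1‖ ^ 2 := by
    filter_upwards [ae_prod_snd_mem] with p hp
    rw [← mul_pow]
    gcongr
    exact (G p.2).le_of_opNorm_le (hR _ hp) _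
  have hi : Integrable (fun p : E × ℝ => R ^ 2 * ‖p.1‖ ^ 2)
      (ρ.prod (volume.restrict (Set.Icc (0 : ℝ) 1))) := (hρ.comp_fst _).const_mul _
  have hi' : Integrable (fun p : E × ℝ => ‖G p.2 p.1‖ ^ 2)
      (ρ.prod (volume.restrict (Set.Icc (0 : ℝ) 1))) :=
    hi.mono' ((continuous_flow hG).norm.pow 2).aestronglyMeasurable (by
      filter_upwards [hb] with p hp
      rwa [Real.norm_of_nonneg (by positivity)])
  refine ⟨hi', (integral_mono_ae hi' hi hb).trans_eq ?_⟩
  rw [integral_const_mul, integral_prod _ (hρ.comp_fst _)]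
  simp

/-- The flow enters only through `R`, which bounds it and the inverses of its adjoints, so `K`
serves all flows with that bound. -/
theorem gradient_estimate_of_flow {ν : Measure E} (hν : IsSymmLevyMeasure ν) {α C : ℝ}
    (hα : 0 < α) (hC0 : 0 < C) (hC : ∀ u : E, C * ‖u‖ ^ α ≤ symbol ν u) {R : ℝ} (hR0 : 0 < R) :
    ∃ K : ℝ, 0 ≤ K ∧ ∀ G : ℝ → E →L[ℝ] E, Continuous G →
      (∀ θ ∈ Set.Icc (0 : ℝ) 1, ‖G θ‖ ≤ R) →
      (∀ θ ∈ Set.Icc (0 : ℝ) 1, ∀ u, ‖u‖ ≤ R * ‖(G θ).adjoint u‖) →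
      ∀ L : Measure E, IsProbabilityMeasure L →
        (∀ u, charFun L u =
          Complex.exp (-(∫ θ in Set.Icc (0 : ℝ) 1, symbol ν ((G θ).adjoint u) : ℝ))) →
        ∀ (f : E → ℝ) (B : ℝ), Measurable f → (∀ x, |f x| ≤ B) →
          Differentiable ℝ (fun z => ∫ y, f (z + y) ∂L) ∧
            ∀ z, ‖fderiv ℝ (fun z => ∫ y, f (z + y) ∂L) z‖ ≤ K * B := by
  set ν₁ := ν.restrict (Metric.closedBall 0 1)
  set ν₂ := ν.restrict (Metric.closedBall 0 1)ᶜ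
  have := hν.sFinite
  have hfin : IsFiniteMeasure ν₂ := hν.isFiniteMeasure
  -- The flow moves the unit ball into radius `R` and scales the second moment by at most `R ^ 2`;
  -- its inverse costs `R⁻¹ ^ α` in the lower bound. Removing the large jumps lowers the symbol by
  -- at most twice their mass, since `1 - cos ≤ 2`.
  obtain ⟨K, hK0, hK⟩ := exists_schwartz_density (E := E) (R := R)
    (M₂ := R ^ 2 * ∫ y, ‖y‖ ^ 2 ∂ν₁) (c := C * (R⁻¹) ^ α) (M := 2 * ν₂.real Set.univ) (α := α)
    (by positivity) hα hR0.le
  refine ⟨K, hK0, fun G hG hGR hGinv L hL hchar f B hf hB => ?_⟩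
  have hm := (continuous_flow hG).measurable
  have hsq := integrable_sq_comp_flow hG hGR hν.integrable_sq
  have hfin2 : IsFiniteMeasure (flowMeasure ν₂ G) := isFiniteMeasure_flowMeasure
  have hsqm : AEStronglyMeasurable (fun y : E => ‖y‖ ^ 2) (flowMeasure ν₁ G) := by fun_prop
  have hint : Integrable (fun y => ‖y‖ ^ 2) (flowMeasure ν₁ G) :=
    (integrable_map_measure hsqm hm.aemeasurable).2 hsq.1
  have hs1 := fun u => symbol_flowMeasure hG u (integrable_one_sub_cos_of_sq hint u)
  have hs2 := fun u => symbol_flowMeasure hG u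
    (integrable_one_sub_cos_of_finite (flowMeasure ν₂ G) u)
  have hc1 : ∀ u, IntegrableOn (fun θ => symbol ν₁ ((G θ).adjoint u)) (Set.Icc 0 1) := fun u =>
    ((continuous_symbol_of_sq hν.integrable_sq).comp
      (continuous_adjoint_flow hG u)).continuousOn.integrableOn_compact isCompact_Icc
  have hc2 : ∀ u, IntegrableOn (fun θ => symbol ν₂ ((G θ).adjoint u)) (Set.Icc 0 1) := fun u =>
    ((continuous_symbol_of_finite ν₂).comp
      (continuous_adjoint_flow hG u)).continuousOn.integrableOn_compact isCompact_Icc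
  have hbd : ∀ᵐ y ∂flowMeasure ν₁ G, ‖y‖ ≤ R := by
    rw [flowMeasure, ae_map_iff hm.aemeasurable (measurableSet_le measurable_norm measurable_const)]
    have h1 : ∀ᵐ p ∂ν₁.prod (volume.restrict (Set.Icc (0 : ℝ) 1)),
        p.1 ∈ Metric.closedBall (0 : E) 1 :=
      Measure.quasiMeasurePreserving_fst.ae
        (ae_restrict_mem Metric.isClosed_closedBall.measurableSet)
    filter_upwards [h1, ae_prod_snd_mem] with p hp1 hp2
    have hp1' : ‖p.1‖ ≤ 1 := by simpa using hp1
    calc ‖G p.2 p.1‖ ≤ R * ‖p.1‖ := (G p.2).le_of_opNorm_le (hGR _ hp2) _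
      _ ≤ R * 1 := by gcongr
      _ = R := mul_one R
  have hmom : ∫ y, ‖y‖ ^ 2 ∂flowMeasure ν₁ G ≤ R ^ 2 * ∫ y, ‖y‖ ^ 2 ∂ν₁ := by
    rw [flowMeasure, integral_map hm.aemeasurable (by fun_prop)]
    exact hsq.2
  have hlow : ∀ u : E, C * R⁻¹ ^ α * ‖u‖ ^ α - 2 * ν₂.real Set.univ ≤
      ∫ y, (1 - Real.cos (inner ℝ u y)) ∂flowMeasure ν₁ G := by
    intro u
    change _ ≤ symbol (flowMeasure ν₁ G) u
    rw [hs1]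
    have hconst : C * R⁻¹ ^ α * ‖u‖ ^ α - 2 * ν₂.real Set.univ =
        ∫ θ in Set.Icc (0 : ℝ) 1, (C * R⁻¹ ^ α * ‖u‖ ^ α - 2 * ν₂.real Set.univ) := by simp
    rw [hconst]
    refine setIntegral_mono_on (by simp) (hc1 u) measurableSet_Icc fun θ hθ => ?_
    have h1 := symbol_le_of_finite ν₂ ((G θ).adjoint u)
    have h2 := hC ((G θ).adjoint u)
    rw [hν.symbol_eq_add] at h2
    have h3 : R⁻¹ ^ α * ‖u‖ ^ α ≤ ‖(G θ).adjoint u‖ ^ α := by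
      rw [← Real.mul_rpow (by positivity) (norm_nonneg u)]
      gcongr
      rw [inv_mul_le_iff₀ hR0]
      exact hGinv θ hθ u
    have h4 := mul_le_mul_of_nonneg_left h3 hC0.le
    rw [mul_assoc]
    linarith
  obtain ⟨q, hq, hqK⟩ := hK (flowMeasure ν₁ G) hbd hint hmom hlow
  have := gradient_estimate_of_charFun (L := L) (m := compoundPoisson (flowMeasure ν₂ G)) q
    (fun u => ?_) hf hB
  · refine ⟨this.1, fun z => (this.2 z).trans ?_⟩
    have : 0 ≤ B := (abs_nonneg _).trans (hB 0)
    gcongr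
  · rw [hchar, hq, charFun_compoundPoisson, integral_exp_inner_sub_one_of_symm
      (flowMeasure_symm hG hν.symm_restrict_compl), ← Complex.exp_add]
    congr 1
    change _ = -((symbol (flowMeasure ν₁ G) u : ℝ) : ℂ) + -((symbol (flowMeasure ν₂ G) u : ℝ) : ℂ)
    rw [hs1, hs2, ← neg_add, ← Complex.ofReal_add, ← integral_add (hc1 u) (hc2 u)]
    simp_rw [hν.symbol_eq_add]
    rfl

end FlowMeasure

/-! ### Càdlàg paths and their Riemann sums -/

section Paths

variable {E : Type*} [NormedAddCommGroup E]

/-- The smallest point of the grid of mesh `t / (N + 1)` that is at least `s`. -/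
def gridCeil (t : ℝ) (N : ℕ) (s : ℝ) : ℝ :=
  ⌈s / (t / (N + 1))⌉ * (t / (N + 1))

theorem le_gridCeil {t : ℝ} (ht : 0 < t) (N : ℕ) (s : ℝ) : s ≤ gridCeil t N s := by
  rw [gridCeil, ← div_le_iff₀ (by positivity)]
  exact Int.le_ceil _

theorem gridCeil_le {t : ℝ} (ht : 0 < t) (N : ℕ) (s : ℝ) :
    gridCeil t N s ≤ s + t / (N + 1) := by
  have h := (Int.ceil_lt_add_one (s / (t / (N + 1)))).le
  have hp : 0 < t / ((N : ℝ) + 1) := by positivity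
  calc gridCeil t N s ≤ (s / (t / (N + 1)) + 1) * (t / (N + 1)) := by
        rw [gridCeil]; gcongr
    _ = s + t / (N + 1) := by field_simp

/-- Rounding up gives convergence from the right, which is all that a right-continuous path can use.
-/
theorem tendsto_gridCeil {t : ℝ} (ht : 0 < t) (s : ℝ) :
    Tendsto (fun N => gridCeil t N s) atTop (𝓝[≥] s) := by
  refine tendsto_nhdsWithin_iff.2 ⟨?_, Eventually.of_forall fun N => le_gridCeil ht N s⟩
  have h : Tendsto (fun N : ℕ => s + t / ((N : ℝ) + 1)) atTop (𝓝 (s + 0)) :=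
    tendsto_const_nhds.add (tendsto_const_nhds.div_atTop
      (tendsto_atTop_add_const_right _ _ tendsto_natCast_atTop_atTop))
  rw [add_zero] at h
  exact tendsto_of_tendsto_of_tendsto_of_le_of_le tendsto_const_nhds h
    (fun N => le_gridCeil ht N s) (fun N => gridCeil_le ht N s)

theorem gridCeil_eq {t : ℝ} (ht : 0 < t) (N k : ℕ) {s : ℝ}
    (hs : s ∈ Set.Ioc (k * (t / (N + 1))) ((k + 1 : ℕ) * (t / (N + 1)))) :
    gridCeil t N s = (k + 1 : ℕ) * (t / (N + 1)) := by
  have hp : 0 < t / ((N : ℝ) + 1) := by positivity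
  have : ⌈s / (t / ((N : ℝ) + 1))⌉ = (k + 1 : ℤ) := by
    rw [Int.ceil_eq_iff]
    constructor
    · rw [lt_div_iff₀ hp]
      simpa using hs.1
    · rw [div_le_iff₀ hp]
      simpa using hs.2
  rw [gridCeil, this]
  push_cast
  ring

/-- A right-continuous path that is bounded on every half-line `(-∞, T]`. -/
structure IsTamePath (z : ℝ → E) : Prop where
  rightCts : ∀ s, ContinuousWithinAt z (Set.Ici s) s
  bdd : ∀ T, ∃ M, ∀ s ≤ T, ‖z s‖ ≤ M

theorem IsTamePath.tendsto_gridCeil {z : ℝ → E} (hz : IsTamePath z) {t : ℝ} (ht : 0 < t) (s : ℝ) :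
    Tendsto (fun N => z (gridCeil t N s)) atTop (𝓝 (z s)) :=
  (hz.rightCts s).tendsto.comp (OUGradient.tendsto_gridCeil ht s)

/-- The left limit and right continuity bound `z` near each time; compactness of `[0, T]` makes the
bound global. -/
theorem exists_bound_of_isCadlag {z : ℝ≥0 → E} (hz : IsCadlag z) (T : ℝ≥0) :
    ∃ M, ∀ s ≤ T, ‖z s‖ ≤ M := by
  have hc : IsCompact (Set.Icc 0 T) := isCompact_Icc
  obtain ⟨M, hM⟩ := hc.induction_on (p := fun S => ∃ M, ∀ s ∈ S, ‖z s‖ ≤ M)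
    ⟨0, by simp⟩ (fun S S' hSS' ⟨M, hM⟩ => ⟨M, fun s hs => hM s (hSS' hs)⟩)
    (fun S S' ⟨M, hM⟩ ⟨M', hM'⟩ => ⟨max M M', fun s hs => hs.elim
      (fun h => (hM s h).trans (le_max_left _ _)) (fun h => (hM' s h).trans (le_max_right _ _))⟩)
    (fun t _ => by
      obtain ⟨hr, l, hl⟩ := hz t
      have h1 : ∀ᶠ s in 𝓝[<] t, ‖z s‖ ≤ max (‖l‖ + 1) (‖z t‖ + 1) :=
        (hl.norm.eventually_le_const (lt_add_one ‖l‖)).mono fun s hs => hs.trans (le_max_left _ _)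
      have h2 : ∀ᶠ s in 𝓝[≥] t, ‖z s‖ ≤ max (‖l‖ + 1) (‖z t‖ + 1) :=
        (hr.tendsto.norm.eventually_le_const (lt_add_one ‖z t‖)).mono
          fun s hs => hs.trans (le_max_right _ _)
      have h3 : ∀ᶠ s in 𝓝[<] t ⊔ 𝓝[≥] t, ‖z s‖ ≤ max (‖l‖ + 1) (‖z t‖ + 1) :=
        eventually_sup.2 ⟨h1, h2⟩
      rw [nhdsLT_sup_nhdsGE] at h3
      exact ⟨_, mem_nhdsWithin_of_mem_nhds h3, _, fun s hs => hs⟩)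
  exact ⟨M, fun s hs => hM s ⟨zero_le, hs⟩⟩

theorem isTamePath_of_isCadlag {z : ℝ≥0 → E} (hz : IsCadlag z) :
    IsTamePath fun s : ℝ => z s.toNNReal where
  rightCts s := (hz s.toNNReal).1.comp (by fun_prop)
    fun _ hr => Real.toNNReal_le_toNNReal hr
  bdd T := by
    obtain ⟨M, hM⟩ := exists_bound_of_isCadlag hz T.toNNReal
    exact ⟨M, fun s hs => hM _ (Real.toNNReal_le_toNNReal hs)⟩

section Integrals

variable [NormedSpace ℝ E] [FiniteDimensional ℝ E] {F : Type*} [NormedAddCommGroup F]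
  [NormedSpace ℝ F]

theorem stronglyMeasurable_comp_gridCeil (z : ℝ → E) (t : ℝ) (N : ℕ) :
    StronglyMeasurable fun s => z (gridCeil t N s) := by
  have h : StronglyMeasurable fun k : ℤ => z (k * (t / (N + 1))) :=
    StronglyMeasurable.of_discrete
  exact h.comp_measurable (Int.measurable_ceil.comp (measurable_id.div_const _))

theorem IsTamePath.stronglyMeasurable {z : ℝ → E} (hz : IsTamePath z) : StronglyMeasurable z :=
  stronglyMeasurable_of_tendsto atTop (fun N => stronglyMeasurable_comp_gridCeil z 1 N)
    (tendsto_pi_nhds.2 fun s => hz.tendsto_gridCeil one_pos s)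

theorem aestronglyMeasurable_clm_apply {H : ℝ → E →L[ℝ] F} (hH : Continuous H) {z : ℝ → E}
    (hz : StronglyMeasurable z) (m : Measure ℝ) :
    AEStronglyMeasurable (fun s => H s (z s)) m := by
  have h : Continuous fun p : (E →L[ℝ] F) × E => p.1 p.2 := isBoundedBilinearMap_apply.continuous
  exact h.comp_aestronglyMeasurable (hH.aestronglyMeasurable.prodMk hz.aestronglyMeasurable)

theorem IsTamePath.intervalIntegrable {z : ℝ → E} (hz : IsTamePath z) {H : ℝ → E →L[ℝ] F}
    (hH : Continuous H) (a b : ℝ) : IntervalIntegrable (fun s => H s (z s)) volume a b := by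
  obtain ⟨M, hM⟩ := hz.bdd (max a b)
  refine ((hH.norm.mul_const M).intervalIntegrable a b).mono_fun'
    (aestronglyMeasurable_clm_apply hH hz.stronglyMeasurable _) ?_
  filter_upwards [ae_restrict_mem measurableSet_uIoc] with s hs
  refine ((H s).le_opNorm _).trans ?_
  gcongr
  exact hM s hs.2

/-- Each sum is exactly the integral of `H` against the path frozen at right endpoints of the grid,
so dominated convergence applies. -/
theorem IsTamePath.tendsto_sum_integral {z : ℝ → E} (hz : IsTamePath z) {H : ℝ → E →L[ℝ] F}
    (hH : Continuous H) {t : ℝ} (ht : 0 < t) :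
    Tendsto (fun N : ℕ => ∑ k ∈ Finset.range (N + 1),
      ∫ s in (k * (t / (N + 1)))..((k + 1 : ℕ) * (t / (N + 1))),
        H s (z ((k + 1 : ℕ) * (t / (N + 1))))) atTop (𝓝 (∫ s in (0 : ℝ)..t, H s (z s))) := by
  have hle : ∀ N k : ℕ, (k : ℝ) * (t / (N + 1)) ≤ (k + 1 : ℕ) * (t / (N + 1)) := by
    intro N k
    push_cast
    gcongr
    linarith
  have heq : ∀ N k : ℕ, Set.EqOn (fun s => H s (z ((k + 1 : ℕ) * (t / (N + 1)))))
      (fun s => H s (z (gridCeil t N s)))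
      (Set.uIoc (k * (t / (N + 1))) ((k + 1 : ℕ) * (t / (N + 1)))) := by
    intro N k s hs
    rw [Set.uIoc_of_le (hle N k)] at hs
    simp only [gridCeil_eq ht N k hs]
  have hsum : ∀ N : ℕ, ∑ k ∈ Finset.range (N + 1),
      ∫ s in (k * (t / (N + 1)))..((k + 1 : ℕ) * (t / (N + 1))),
        H s (z ((k + 1 : ℕ) * (t / (N + 1)))) =
      ∫ s in (0 : ℝ)..t, H s (z (gridCeil t N s)) := by
    intro N
    have h := intervalIntegral.sum_integral_adjacent_intervals (μ := volume)
      (f := fun s => H s (z (gridCeil t N s))) (a := fun k : ℕ => (k : ℝ) * (t / (N + 1)))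
      (n := N + 1) fun k _ => ((hH.clm_apply continuous_const).intervalIntegrable _ _).congr
        (heq N k)
    have h0 : ((0 : ℕ) : ℝ) * (t / ((N : ℝ) + 1)) = 0 := by simp
    have h1 : ((N + 1 : ℕ) : ℝ) * (t / ((N : ℝ) + 1)) = t := by
      push_cast
      field_simp
    rw [h0, h1] at h
    rw [← h]
    exact Finset.sum_congr rfl fun k _ => intervalIntegral.integral_congr_ae (ae_of_all _ (heq N k))
  simp_rw [hsum]
  -- Rounding up may pass `t`, but by at most one mesh, which is at most `t`.
  obtain ⟨M, hM⟩ := hz.bdd (t + t)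
  refine intervalIntegral.tendsto_integral_filter_of_dominated_convergence
    (fun s => ‖H s‖ * M)
    (Eventually.of_forall fun N =>
      aestronglyMeasurable_clm_apply hH (stronglyMeasurable_comp_gridCeil z t N) _)
    (Eventually.of_forall fun N => ae_of_all _ fun s hs => ?_)
    ((hH.norm.mul_const M).intervalIntegrable _ _) (ae_of_all _ fun s _ => ?_)
  · rw [Set.uIoc_of_le ht.le] at hs
    refine ((H s).le_opNorm _).trans ?_
    gcongr
    refine hM _ ((gridCeil_le ht N s).trans (add_le_add hs.2 ?_))
    exact div_le_self ht.le (by linarith [N.cast_nonneg (α := ℝ)])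
  · exact ((H s).continuous.tendsto _).comp (hz.tendsto_gridCeil ht s)

end Integrals

end Paths

/-! ### The linear flow and pathwise variation of constants -/

section Flow

variable {E : Type*} [NormedAddCommGroup E] [NormedSpace ℝ E] [FiniteDimensional ℝ E]

/-- The linear flow `e^{sA}`. -/
def flow (A : E →L[ℝ] E) (s : ℝ) : E →L[ℝ] E :=
  NormedSpace.exp (s • A)

variable (A : E →L[ℝ] E)

theorem hasDerivAt_flow (s : ℝ) : HasDerivAt (flow A) (flow A s * A) s := by
  have := FiniteDimensional.complete ℝ E
  exact hasDerivAt_exp_smul_const A s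

theorem continuous_flow_exp : Continuous (flow A) :=
  continuous_iff_continuousAt.2 fun s => (hasDerivAt_flow A s).continuousAt

theorem flow_zero : flow A 0 = 1 := by
  simp [flow]

theorem flow_add (s t : ℝ) : flow A (s + t) = flow A s * flow A t := by
  have := FiniteDimensional.complete ℝ E
  let _ : NormedAlgebra ℚ (E →L[ℝ] E) := .restrictScalars ℚ ℝ _
  rw [flow, add_smul, NormedSpace.exp_add_of_commute]
  · rfl
  · exact ((Commute.refl A).smul_left s).smul_right t

theorem flow_neg_apply (s : ℝ) (v : E) : flow A s (flow A (-s) v) = v := by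
  have h := flow_add A s (-s)
  rw [add_neg_cancel, flow_zero] at h
  exact (congrArg (fun T : E →L[ℝ] E => T v) h).symm

theorem hasDerivAt_flow_neg (s : ℝ) :
    HasDerivAt (fun s => flow A (-s)) (-(flow A (-s) * A)) s := by
  have := (hasDerivAt_flow A (-s)).scomp s (hasDerivAt_neg s)
  exact this.congr_deriv (by simp)

theorem continuous_flow_neg : Continuous fun s => flow A (-s) :=
  (continuous_flow_exp A).comp continuous_neg

/-- The stochastic convolution `∫_0^t e^{(t-s)A} dz_s`, after an integration by parts. -/
def stochConv (z : ℝ → E) (t : ℝ) : E :=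
  z t + flow A t (∫ s in (0 : ℝ)..t, (flow A (-s) * A) (z s))

theorem continuous_flow_neg_mul : Continuous fun s => flow A (-s) * A :=
  (continuous_flow_neg A).mul continuous_const

/-- With `I` the primitive of `A x`, the function `e^{-sA} (I s + x₀)` is continuous with right
derivative `e^{-sA} A (z s)`, because `x - I - x₀ = z`. One-sided derivatives suffice for the
fundamental theorem of calculus, so jumps of the path do no harm. -/
theorem eq_flow_add_stochConv {x z : ℝ → E} (hx : IsTamePath x) (hz : IsTamePath z) {x₀ : E}
    (h : ∀ t, 0 ≤ t → x t = x₀ + (∫ s in (0 : ℝ)..t, A (x s)) + z t) {t : ℝ} (ht : 0 ≤ t) :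
    x t = flow A t x₀ + stochConv A z t := by
  have := FiniteDimensional.complete ℝ E
  set I : ℝ → E := fun t => ∫ s in (0 : ℝ)..t, A (x s) with hI
  have hint : ∀ a b, IntervalIntegrable (fun s => A (x s)) volume a b := fun a b =>
    hx.intervalIntegrable (H := fun _ => A) continuous_const a b
  have hIc : Continuous I := intervalIntegral.continuous_primitive hint 0
  have hId : ∀ s, HasDerivWithinAt I (A (x s)) (Set.Ioi s) s := fun s =>
    (intervalIntegral.integral_hasDerivWithinAt_right (s := Set.Ici s) (t := Set.Ioi s) (hint 0 s)
      (A.continuous.comp_stronglyMeasurable hx.stronglyMeasurable).stronglyMeasurableAtFilter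
      ((A.continuous.continuousAt.comp_continuousWithinAt (hx.rightCts s)).mono
        Set.Ioi_subset_Ici_self)).mono Set.Ioi_subset_Ici_self
  have hd : ∀ s ∈ Set.Ioo (min 0 t) (max 0 t),
      HasDerivWithinAt (fun s => flow A (-s) (I s + x₀)) ((flow A (-s) * A) (z s))
        (Set.Ioi s) s := by
    intro s hs
    rw [min_eq_left ht] at hs
    have h1 := (hasDerivAt_flow_neg A s).hasDerivWithinAt (s := Set.Ioi s) |>.clm_apply
      ((hId s).add_const x₀)
    convert h1 using 1
    have h2 := h s hs.1.le
    have h3 : z s = x s - (I s + x₀) := by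
      rw [h2]
      simp only [hI]
      abel
    rw [h3]
    simp
    abel
  have h1 := intervalIntegral.integral_eq_sub_of_hasDeriv_right (a := 0) (b := t)
    (f := fun s => flow A (-s) (I s + x₀))
    (((continuous_flow_neg A).clm_apply (hIc.add continuous_const)).continuousOn) hd
    (hz.intervalIntegrable (continuous_flow_neg_mul A) 0 t)
  have h2 : I 0 = 0 := by simp [hI]
  rw [h2, neg_zero, flow_zero, zero_add] at h1
  have h3 : flow A t (∫ s in (0 : ℝ)..t, (flow A (-s) * A) (z s)) = I t + x₀ - flow A t x₀ := by
    rw [h1, map_sub, flow_neg_apply]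
    rfl
  rw [stochConv, h3, h t ht]
  simp only [hI]
  abel

theorem integral_flow_neg_mul (a b : ℝ) (v : E) :
    ∫ s in a..b, (flow A (-s) * A) v = flow A (-a) v - flow A (-b) v := by
  have := FiniteDimensional.complete ℝ E
  have hd : ∀ s ∈ Set.uIcc a b, HasDerivAt (fun s => -(flow A (-s) v)) ((flow A (-s) * A) v) s := by
    intro s _
    have := ((hasDerivAt_flow_neg A s).clm_apply (hasDerivAt_const s v)).neg
    exact this.congr_deriv (by simp)
  rw [intervalIntegral.integral_eq_sub_of_hasDerivAt hd
    (((continuous_flow_neg_mul A).clm_apply continuous_const).intervalIntegrable _ _)]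
  abel

/-- Abel summation: the differences of `e^{-sA}` over grid cells are integrals of `e^{-sA} A`, so
the sums of increments become Riemann sums of the integral in `stochConv`. -/
theorem tendsto_sum_flow_sub {z : ℝ → E} (hz : IsTamePath z) (hz0 : z 0 = 0) {t : ℝ}
    (ht : 0 < t) :
    Tendsto (fun N : ℕ => ∑ k ∈ Finset.range (N + 1), flow A (t - k * (t / (N + 1)))
      (z ((k + 1 : ℕ) * (t / (N + 1))) - z (k * (t / (N + 1))))) atTop (𝓝 (stochConv A z t)) := by
  have hsum : ∀ N : ℕ, ∑ k ∈ Finset.range (N + 1), flow A (t - k * (t / (N + 1)))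
      (z ((k + 1 : ℕ) * (t / (N + 1))) - z (k * (t / (N + 1)))) =
      z t + flow A t (∑ k ∈ Finset.range (N + 1),
        ∫ s in (k * (t / (N + 1)))..((k + 1 : ℕ) * (t / (N + 1))),
          (flow A (-s) * A) (z ((k + 1 : ℕ) * (t / (N + 1))))) := by
    intro N
    have h1 : ((N + 1 : ℕ) : ℝ) * (t / ((N : ℝ) + 1)) = t := by
      push_cast
      field_simp
    have htel := Finset.sum_range_sub (fun k : ℕ =>
      flow A (-(k * (t / ((N : ℝ) + 1)))) (z (k * (t / (N + 1))))) (N + 1)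
    rw [h1, Nat.cast_zero, zero_mul, hz0, map_zero, sub_zero] at htel
    rw [← flow_neg_apply A t (z t), ← map_add, ← htel, ← Finset.sum_add_distrib, map_sum]
    refine Finset.sum_congr rfl fun k _ => ?_
    rw [integral_flow_neg_mul, sub_eq_add_neg t, flow_add, mul_apply_eq_comp, map_sub]
    congr 1
    abel
  simp_rw [hsum]
  exact tendsto_const_nhds.add (((flow A t).continuous.tendsto _).comp
    (hz.tendsto_sum_integral (continuous_flow_neg_mul A) ht))

end Flow

/-! ### The characteristic function of the stochastic convolution -/

section NoiseLaw

variable {n : ℕ} {Ω : Type*} [MeasurableSpace Ω] {P : Measure Ω}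
  {Z : ℝ≥0 → Ω → EuclideanSpace ℝ (Fin n)}

/-- The Riemann sum that approximates the stochastic convolution. -/
def stochSum (A : EuclideanSpace ℝ (Fin n) →L[ℝ] EuclideanSpace ℝ (Fin n))
    (Z : ℝ≥0 → Ω → EuclideanSpace ℝ (Fin n)) (t : ℝ) (N : ℕ) (ω : Ω) :
    EuclideanSpace ℝ (Fin n) :=
  ∑ k ∈ Finset.range (N + 1), flow A (t - k * (t / (N + 1)))
    (Z ((k + 1 : ℕ) * (t / (N + 1))).toNNReal ω - Z (k * (t / (N + 1))).toNNReal ω)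

variable (A : EuclideanSpace ℝ (Fin n) →L[ℝ] EuclideanSpace ℝ (Fin n))

theorem measurable_stochSum (hZ : ∀ t, Measurable (Z t)) (t : ℝ) (N : ℕ) :
    Measurable (stochSum A Z t N) := by
  unfold stochSum
  fun_prop

theorem ae_tendsto_stochSum (hZ : IsLevyProcess Z P) {t : ℝ} (ht : 0 < t) :
    ∀ᵐ ω ∂P, Tendsto (fun N => stochSum A Z t N ω) atTop
      (𝓝 (stochConv A (fun s => Z s.toNNReal ω) t)) := by
  filter_upwards [hZ.cadlag, hZ.zero] with ω h1 h2
  exact tendsto_sum_flow_sub A (isTamePath_of_isCadlag h1) (by simpa using h2) ht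

theorem aemeasurable_stochConv (hZ : IsLevyProcess Z P) {t : ℝ} (ht : 0 < t) :
    AEMeasurable (fun ω => stochConv A (fun s => Z s.toNNReal ω) t) P :=
  aemeasurable_of_tendsto_metrizable_ae atTop
    (fun N => (measurable_stochSum A hZ.measurable t N).aemeasurable) (ae_tendsto_stochSum A hZ ht)

variable [IsProbabilityMeasure P] {φ : EuclideanSpace ℝ (Fin n) → ℝ}

/-- Independence of the increments factors the characteristic function, and stationarity together
with passing to the adjoint evaluates each factor. -/
theorem charFun_stochSum (hZ : IsLevyProcess Z P)
    (hφ : ∀ (t : ℝ≥0) u, charFun (P.map (Z t)) u = Complex.exp (-(t * φ u : ℝ)))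
    {t : ℝ} (ht : 0 < t) (N : ℕ) (u : EuclideanSpace ℝ (Fin n)) :
    charFun (P.map (stochSum A Z t N)) u = Complex.exp (-(∑ k ∈ Finset.range (N + 1),
      t / (N + 1) * φ ((flow A ((k + 1 : ℕ) * (t / (N + 1)))).adjoint u) : ℝ)) := by
  have hp : 0 < t / ((N : ℝ) + 1) := by positivity
  have hmono : Monotone fun k : ℕ => (k * (t / ((N : ℝ) + 1))).toNNReal := by
    intro a b hab
    refine Real.toNNReal_le_toNNReal ?_
    gcongr
  have hind := (hZ.indep.nat hmono).comp
    (fun k v => flow A (t - k * (t / ((N : ℝ) + 1))) v) (fun k => by fun_prop)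
  have hZm := hZ.measurable
  have hprod := iIndepFun.charFun_map_fun_finsetSum_eq_prod (P := P)
    (X := fun (k : ℕ) ω => flow A (t - k * (t / ((N : ℝ) + 1)))
      (Z ((k + 1 : ℕ) * (t / (N + 1))).toNNReal ω - Z (k * (t / (N + 1))).toNNReal ω))
    (s := Finset.range (N + 1)) (fun k _ => by fun_prop)
    (hind.restrict _)
  have hfun : charFun (P.map (stochSum A Z t N)) u = ∏ k ∈ Finset.range (N + 1),
      charFun (P.map fun ω => flow A (t - k * (t / ((N : ℝ) + 1)))
      (Z ((k + 1 : ℕ) * (t / (N + 1))).toNNReal ω - Z (k * (t / (N + 1))).toNNReal ω)) u := by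
    rw [← Finset.prod_apply]
    exact congrFun hprod u
  rw [hfun]
  have hterm : ∀ k : ℕ, charFun (P.map fun ω => flow A (t - k * (t / ((N : ℝ) + 1)))
      (Z ((k + 1 : ℕ) * (t / (N + 1))).toNNReal ω - Z (k * (t / (N + 1))).toNNReal ω)) u =
      Complex.exp (-(t / (N + 1) *
        φ ((flow A (t - k * (t / ((N : ℝ) + 1)))).adjoint u) : ℝ)) := by
    intro k
    have hadd : ((k + 1 : ℕ) * (t / ((N : ℝ) + 1))).toNNReal =
        (k * (t / ((N : ℝ) + 1))).toNNReal + (t / ((N : ℝ) + 1)).toNNReal := by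
      rw [← Real.toNNReal_add (by positivity) hp.le]
      congr 1
      push_cast
      ring
    have hst := (hZ.stationary (k * (t / ((N : ℝ) + 1))).toNNReal
      (t / ((N : ℝ) + 1)).toNNReal).map_eq
    have h1 := hφ (t / ((N : ℝ) + 1)).toNNReal ((flow A (t - k * (t / ((N : ℝ) + 1)))).adjoint u)
    rw [Real.coe_toNNReal _ hp.le] at h1
    rw [← h1, ← hst, charFun_apply, charFun_apply, integral_map (by fun_prop) (by fun_prop),
      integral_map (by fun_prop) (by fun_prop), hadd]
    simp only [ContinuousLinearMap.adjoint_inner_right]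
  simp_rw [hterm]
  -- Reversing the sum by `k ↦ N - k` turns the flow times `t - k h`, with `h` the mesh, into `(k +
  -- 1) h`.
  rw [← Complex.exp_sum, Finset.sum_neg_distrib, ← Complex.ofReal_sum,
    ← Finset.sum_range_reflect _ (N + 1)]
  congr 3
  refine Finset.sum_congr rfl fun k hk => ?_
  have hk' : k ≤ N := Nat.lt_succ_iff.1 (Finset.mem_range.1 hk)
  congr 5
  rw [show N + 1 - 1 - k = N - k by omega, Nat.cast_sub hk']
  push_cast
  field_simp
  ring

theorem tendsto_sum_mul (g : ℝ → ℝ) (hg : Continuous g) {t : ℝ} (ht : 0 < t) :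
    Tendsto (fun N : ℕ => ∑ k ∈ Finset.range (N + 1),
      t / (N + 1) * g ((k + 1 : ℕ) * (t / (N + 1)))) atTop (𝓝 (∫ s in (0 : ℝ)..t, g s)) := by
  -- A tame path must be bounded on whole half-lines `(-∞, T]`; freezing `g` on negative times
  -- ensures this and leaves the integral unchanged.
  have hz : IsTamePath fun s => g (max 0 s) := by
    have hc : Continuous fun s => g (max 0 s) := by fun_prop
    refine ⟨fun s => hc.continuousWithinAt, fun T => ?_⟩
    obtain ⟨M, hM⟩ := (isCompact_Icc (a := (0 : ℝ)) (b := max 0 T)).exists_bound_of_continuousOn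
      hg.continuousOn
    exact ⟨M, fun s hs => hM _ ⟨le_max_left _ _, max_le_max le_rfl hs⟩⟩
  have h := hz.tendsto_sum_integral (H := fun _ => ContinuousLinearMap.id ℝ ℝ) continuous_const ht
  have h2 : ∫ s in (0 : ℝ)..t, (ContinuousLinearMap.id ℝ ℝ) (g (max 0 s)) =
      ∫ s in (0 : ℝ)..t, g s := by
    refine intervalIntegral.integral_congr fun s hs => ?_
    rw [Set.uIcc_of_le ht.le] at hs
    simp [max_eq_right hs.1]
  rw [h2] at h
  refine h.congr fun N => Finset.sum_congr rfl fun k _ => ?_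
  rw [intervalIntegral.integral_const, max_eq_right (by positivity)]
  push_cast
  simp
  left
  ring

theorem charFun_stochConv (hZ : IsLevyProcess Z P) (hφc : Continuous φ)
    (hφ : ∀ (t : ℝ≥0) u, charFun (P.map (Z t)) u = Complex.exp (-(t * φ u : ℝ)))
    {t : ℝ} (ht : 0 < t) (u : EuclideanSpace ℝ (Fin n)) :
    charFun (P.map fun ω => stochConv A (fun s => Z s.toNNReal ω) t) u =
      Complex.exp (-(∫ s in (0 : ℝ)..t, φ ((flow A s).adjoint u) : ℝ)) := by
  have hm := aemeasurable_stochConv A hZ ht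
  have hmN := fun N => (measurable_stochSum A hZ.measurable t N).aemeasurable (μ := P)
  have h1 : Tendsto (fun N => charFun (P.map (stochSum A Z t N)) u) atTop
      (𝓝 (charFun (P.map fun ω => stochConv A (fun s => Z s.toNNReal ω) t) u)) := by
    simp only [charFun_apply]
    rw [integral_map hm (by fun_prop)]
    simp_rw [fun N => integral_map (hmN N) (f := fun x : EuclideanSpace ℝ (Fin n) =>
      Complex.exp ((inner ℝ x u : ℝ) * Complex.I)) (by fun_prop)]
    refine tendsto_integral_of_dominated_convergence (fun _ => 1) (fun N => ?_)
      (integrable_const _) (fun N => ae_of_all _ fun ω => ?_) ?_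
    · have := measurable_stochSum A hZ.measurable t N
      fun_prop
    · rw [Complex.norm_exp_ofReal_mul_I]
    · filter_upwards [ae_tendsto_stochSum A hZ ht] with ω hω
      have hc : Continuous fun x : EuclideanSpace ℝ (Fin n) =>
        Complex.exp ((inner ℝ x u : ℝ) * Complex.I) := by fun_prop
      exact (hc.tendsto _).comp hω
  refine tendsto_nhds_unique h1 ?_
  simp_rw [charFun_stochSum A hZ hφ ht]
  have hc : Continuous fun r : ℝ => Complex.exp (-(r : ℂ)) := by fun_prop
  exact (hc.tendsto _).comp (tendsto_sum_mul (fun s => φ ((flow A s).adjoint u))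
    (hφc.comp (continuous_adjoint_flow (continuous_flow_exp A) u)) ht)

end NoiseLaw

/-! ### The Ornstein–Uhlenbeck solution and its rescaling to unit time -/

section OrnsteinUhlenbeck

variable {n : ℕ} {Ω : Type*} [MeasurableSpace Ω] {P : Measure Ω}
  {Z : ℝ≥0 → Ω → EuclideanSpace ℝ (Fin n)}

theorem IsOUSolution.ae_eq {A : Matrix (Fin n) (Fin n) ℝ} {x : EuclideanSpace ℝ (Fin n)}
    {X : ℝ≥0 → Ω → EuclideanSpace ℝ (Fin n)} (hX : IsOUSolution A Z P x X)
    (hZ : IsLevyProcess Z P) (t : ℝ≥0) :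
    ∀ᵐ ω ∂P, X t ω = flow (Matrix.toEuclideanLin A).toContinuousLinearMap t x +
      stochConv (Matrix.toEuclideanLin A).toContinuousLinearMap (fun s => Z s.toNNReal ω) t := by
  filter_upwards [hX.cadlag, hX.equation, hZ.cadlag] with ω h1 h2 h3
  have h := eq_flow_add_stochConv (Matrix.toEuclideanLin A).toContinuousLinearMap
    (isTamePath_of_isCadlag h1) (isTamePath_of_isCadlag h3) (x₀ := x) (t := t)
    (fun s hs => by
      have := h2 s.toNNReal
      rwa [Real.coe_toNNReal _ hs] at this) t.2
  simpa using h

theorem exists_bound_flow {E : Type*} [NormedAddCommGroup E] [NormedSpace ℝ E]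
    [FiniteDimensional ℝ E] (A : E →L[ℝ] E) :
    ∃ R : ℝ, 0 < R ∧ ∀ s ∈ Set.Icc (-1 : ℝ) 1, ‖flow A s‖ ≤ R := by
  obtain ⟨R, hR⟩ := (isCompact_Icc (a := (-1 : ℝ)) (b := 1)).exists_bound_of_continuousOn
    (continuous_flow_exp A).continuousOn
  exact ⟨max R 1, by positivity, fun s hs => (hR s hs).trans (le_max_left _ _)⟩

/-- The adjoint of `e^{-sA}` inverts that of `e^{sA}`. This is how non-degeneracy of the noise
survives the flow. -/
theorem norm_le_mul_norm_adjoint_flow {E : Type*} [NormedAddCommGroup E] [InnerProductSpace ℝ E]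
    [FiniteDimensional ℝ E] (A : E →L[ℝ] E) {R s : ℝ} (hR : ‖flow A (-s)‖ ≤ R) (u : E) :
    ‖u‖ ≤ R * ‖(flow A s).adjoint u‖ := by
  have h : (flow A (-s)).adjoint ((flow A s).adjoint u) = u := by
    refine ext_inner_right ℝ fun v => ?_
    rw [ContinuousLinearMap.adjoint_inner_left, ContinuousLinearMap.adjoint_inner_left,
      flow_neg_apply]
  calc ‖u‖ = ‖(flow A (-s)).adjoint ((flow A s).adjoint u)‖ := by rw [h]
    _ ≤ ‖(flow A (-s)).adjoint‖ * ‖(flow A s).adjoint u‖ := ContinuousLinearMap.le_opNorm _ _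
    _ ≤ _ := by
      gcongr
      rwa [LinearIsometryEquiv.norm_map]

variable [IsProbabilityMeasure P]

/-- By homogeneity the scaling by `t^{-1/α}` produces a factor `t⁻¹`, which is the Jacobian of `s =
θ t`. -/
theorem charFun_smul_stochConv {α : ℝ} {φ : EuclideanSpace ℝ (Fin n) → ℝ} (hα : 0 < α)
    (A : EuclideanSpace ℝ (Fin n) →L[ℝ] EuclideanSpace ℝ (Fin n))
    (hZ : IsLevyProcess Z P) (hφc : Continuous φ)
    (hφ : ∀ (t : ℝ≥0) u, charFun (P.map (Z t)) u = Complex.exp (-(t * φ u : ℝ)))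
    (hs : ∀ l : ℝ, 0 < l → ∀ u, φ (l • u) = l ^ α * φ u) {t : ℝ} (ht : 0 < t)
    (u : EuclideanSpace ℝ (Fin n)) :
    charFun (P.map fun ω => (t ^ (1 / α))⁻¹ • stochConv A (fun s => Z s.toNNReal ω) t) u =
      Complex.exp (-(∫ θ in Set.Icc (0 : ℝ) 1, φ ((flow A (θ * t)).adjoint u) : ℝ)) := by
  have ha : 0 < t ^ (1 / α) := Real.rpow_pos_of_pos ht _
  have hpow : (t ^ (1 / α))⁻¹ ^ α = t⁻¹ := by
    rw [Real.inv_rpow ha.le, ← Real.rpow_mul ht.le, one_div_mul_cancel hα.ne', Real.rpow_one]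
  have hm := aemeasurable_stochConv A hZ ht
  rw [charFun_map_smul_comp hm, charFun_stochConv A hZ hφc hφ ht]
  congr 3
  simp_rw [map_smul, hs _ (inv_pos.2 ha), hpow]
  have h := intervalIntegral.integral_comp_mul_right (a := 0) (b := 1)
    (fun s => φ ((flow A s).adjoint u)) ht.ne'
  rw [zero_mul, one_mul] at h
  rw [intervalIntegral.integral_const_mul, ← smul_eq_mul, ← h,
    intervalIntegral.integral_of_le zero_le_one, integral_Icc_eq_integral_Ioc]

end OrnsteinUhlenbeck

end OUGradient

end

/-! ### The gradient estimate -/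

theorem mainTheorem4 {n : ℕ} {α : ℝ} (hα0 : 0 < α) (hα2 : α < 2)
    (A : Matrix (Fin n) (Fin n) ℝ)
    {Ω : Type*} [MeasurableSpace Ω] (P : Measure Ω) [IsProbabilityMeasure P]
    (Z : ℝ≥0 → Ω → EuclideanSpace ℝ (Fin n)) (hZ : OUGradient.IsSymmNondegStable α Z P) :
    ∃ c : ℝ, 0 < c ∧
      ∀ X : EuclideanSpace ℝ (Fin n) → ℝ≥0 → Ω → EuclideanSpace ℝ (Fin n),
        (∀ x, OUGradient.IsOUSolution A Z P x (X x)) →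
        ∀ t : ℝ≥0, 0 < t → t ≤ 1 →
          ∀ f : EuclideanSpace ℝ (Fin n) → ℝ, Measurable f → BddAbove (Set.range fun x => |f x|) →
            Differentiable ℝ (OUGradient.semigroup P X t f) ∧
            ∀ x, ‖fderiv ℝ (OUGradient.semigroup P X t f) x‖ ≤
              c / (t : ℝ) ^ (1 / α) * OUGradient.supNorm f := by
  obtain ⟨hL, μ, hfin, -, hμS, hμs, hchar, C, hC0, hC⟩ := hZ
  set ν := OUGradient.stableLevyMeasure α μ
  have hν : OUGradient.IsSymmLevyMeasure ν :=
    OUGradient.isSymmLevyMeasure_stableLevyMeasure hα0 hα2 hμS hμs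
  have hlow : ∀ u, C * ‖u‖ ^ α ≤ OUGradient.symbol ν u := fun u => by
    simpa [hν.levyExponent_eq] using hC u
  have hφ : ∀ (t : ℝ≥0) u, charFun (P.map (Z t)) u =
      Complex.exp (-(t * OUGradient.symbol ν u : ℝ)) := by
    intro t u
    have h := hchar t u
    have hm := hL.measurable t
    rw [hν.levyExponent_eq] at h
    rw [charFun_apply, integral_map (by fun_prop) (by fun_prop)]
    simp_rw [mul_comm _ Complex.I, h]
    push_cast
    rw [neg_mul]
  set L := (Matrix.toEuclideanLin A).toContinuousLinearMap
  obtain ⟨R, hR0, hR⟩ := OUGradient.exists_bound_flow L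
  obtain ⟨K, hK0, hK⟩ := OUGradient.gradient_estimate_of_flow hν hα0 hC0 hlow hR0
  -- The `+ 1` only secures strict positivity, as `K` is merely nonnegative.
  refine ⟨K * R + 1, by positivity, fun X hX t ht0 ht1 f hf hfb => ?_⟩
  have ht : (0 : ℝ) < t := ht0
  have ht' : (t : ℝ) ≤ 1 := ht1
  set a : ℝ := (t : ℝ) ^ (1 / α)
  have ha : 0 < a := Real.rpow_pos_of_pos ht _
  set Y : Ω → EuclideanSpace ℝ (Fin n) :=
    fun ω => OUGradient.stochConv L (fun s => Z s.toNNReal ω) t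
  have hY : AEMeasurable Y P := OUGradient.aemeasurable_stochConv L hL ht
  have hYa : AEMeasurable (fun ω => a⁻¹ • Y ω) P := hY.const_smul a⁻¹
  have hfB : ∀ x, |f x| ≤ OUGradient.supNorm f := fun x => le_ciSup hfb x
  have hmem : ∀ θ ∈ Set.Icc (0 : ℝ) 1, θ * t ∈ Set.Icc (-1 : ℝ) 1 ∧
      -(θ * t) ∈ Set.Icc (-1 : ℝ) 1 := by
    intro θ hθ
    have h1 : 0 ≤ θ * t := mul_nonneg hθ.1 ht.le
    have h2 : θ * t ≤ 1 := mul_le_one₀ hθ.2 ht.le ht'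
    exact ⟨⟨by linarith, h2⟩, ⟨by linarith, by linarith⟩⟩
  -- The estimate is applied to `y ↦ f (a • y)`, which undoes the rescaling of the noise and keeps
  -- the same bound as `f`.
  obtain ⟨hd, hb⟩ := hK (fun θ => OUGradient.flow L (θ * t))
    ((OUGradient.continuous_flow_exp L).comp (continuous_id.mul continuous_const))
    (fun θ hθ => hR _ (hmem θ hθ).1)
    (fun θ hθ u => OUGradient.norm_le_mul_norm_adjoint_flow L (hR _ (hmem θ hθ).2) u)
    (P.map fun ω => a⁻¹ • Y ω) (Measure.isProbabilityMeasure_map hYa)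
    (OUGradient.charFun_smul_stochConv hα0 L hL hν.continuous_symbol hφ
      (fun l hl u => OUGradient.symbol_stableLevyMeasure_smul hα0 hα2 hμS hμs hl u) ht)
    (fun y => f (a • y)) (OUGradient.supNorm f) (by fun_prop) (fun y => hfB _)
  set g : EuclideanSpace ℝ (Fin n) → ℝ :=
    fun z => ∫ y, f (a • (z + y)) ∂P.map (fun ω => a⁻¹ • Y ω) with hg_def
  -- The whole dependence on `x` sits in this linear map, and `‖T‖ ≤ a⁻¹ * R` supplies the factor
  -- `t^{-1/α}` through the chain rule.
  set T := a⁻¹ • OUGradient.flow L t with hT_def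
  have hsemi : OUGradient.semigroup P X t f = g ∘ T := by
    ext x
    have hfm : Measurable fun y => f (a • (T x + y)) := by fun_prop
    rw [OUGradient.semigroup, Function.comp_apply, hg_def]
    simp only
    rw [integral_map hYa hfm.aestronglyMeasurable]
    refine integral_congr_ae ?_
    filter_upwards [(hX x).ae_eq hL t] with ω hω
    rw [hω, hT_def, smul_apply, ← smul_add, smul_smul, mul_inv_cancel₀ ha.ne',
      one_smul]
  have hcomp : ∀ x, HasFDerivAt (g ∘ T) ((fderiv ℝ g (T x)).comp T) x := fun x =>
    (hd (T x)).hasFDerivAt.comp x T.hasFDerivAt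
  rw [hsemi]
  refine ⟨fun x => (hcomp x).differentiableAt, fun x => ?_⟩
  have hB0 : 0 ≤ OUGradient.supNorm f := (abs_nonneg _).trans (hfB 0)
  have hT : ‖T‖ ≤ a⁻¹ * R := by
    rw [hT_def, norm_smul, Real.norm_of_nonneg (by positivity)]
    gcongr
    exact hR _ ⟨by linarith, ht'⟩
  rw [(hcomp x).fderiv]
  calc ‖(fderiv ℝ g (T x)).comp T‖ ≤ ‖fderiv ℝ g (T x)‖ * ‖T‖ :=
        ContinuousLinearMap.opNorm_comp_le _ _
    _ ≤ K * OUGradient.supNorm f * (a⁻¹ * R) := by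
        gcongr
        exact hb _
    _ = K * R / a * OUGradient.supNorm f := by ring
    _ ≤ (K * R + 1) / a * OUGradient.supNorm f := by
        gcongr
        linarith
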